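/- Let $d \ge 2$ and $n = d^2+5d+5$, and let $a_0, a_1, \dots, a_{n-1}$ be $n$ distinct vertices, with subscripts taken modulo $n$. For $0 \le i \le n-1$ and $1 \le k \le d$ put $$\sigma_i = \{a_{i-j} : 0 \le j \le d+1\},$$ $$\mu_i = \{a_i\} \cup \{a_{i+j(d+3)-1} : 1 \le j \le d+1\},\qquad \alpha_{k,i} = \{a_i\} \cup \{a_{i-j} : 2 \le j \le d+2-k\} \cup \{a_{i+j(d+3)-1} : 1 \le j \le k\},$$ $$\mu'_i = \{a_{i-j(d+3)} : 0 \le j \le d+1\},\qquad \alpha'_{k,i} = \{a_i\} \cup \{a_{i-j} : 2 \le j \le d+2-k\} \cup \{a_{i-j(d+3)} : 2 \le j \le k+1\}.$$ Let $\mathcal M^{d+1}_n$ be the pure $(d+1)$-dimensional simplicial complex whose facets are all the $\sigma_i$, $\mu_i$, $\alpha_{k,i}$, and let $\mathcal N^{d+1}_n$ be the one whose facets are all the $\sigma_i$, $\mu'_i$, $\alpha'_{k,i}$. Let $M^d_n = \partial \mathcal M^{d+1}_n$ and $N^d_n = \partial \mathcal N^{d+1}_n$, where the boundary $\partial X$ of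 a $(d+1)$-dimensional complex $X$ is the pure $d$-dimensional subcomplex whose facets are the $d$-dimensional faces of $X$ that lie in exactly one facet of $X$. A triangulated $d$-manifold is called orientable if its $d$-dimensional simplices can be oriented so that any two of them that share a $(d-1)$-dimensional face induce opposite orientations on that face. If $d$ is even, then $M^d_n$ and $N^d_n$ are both orientable. If $d$ is odd, then $M^d_n$ and $N^d_n$ are both non-orientable. -/

import Mathlib

namespace SimplicialManifold

variable {V : Type*}

/-- The simplicial complex generated by a set `F` of finite sets: its faces are the nonempty
subsets of members of `F`. -/
def generate (F : Set (Finset V)) : PreAbstractSimplicialComplex V where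
  faces := {τ | τ.Nonempty ∧ ∃ σ ∈ F, τ ⊆ σ}
  isRelLowerSet_faces := by
    rintro τ ⟨hτ, σ, hσ, hsub⟩
    exact ⟨hτ, fun ρ hρ hne => ⟨hne, σ, hσ, hρ.trans hsub⟩⟩

/-- A facet is a maximal face. -/
def IsFacet (X : PreAbstractSimplicialComplex V) (σ : Finset V) : Prop :=
  Maximal (fun τ => τ ∈ X) σ

/-- The boundary of a `D`-dimensional weak pseudomanifold `X`: the pure subcomplex whose facets
are the `(D - 1)`-dimensional faces (i.e. the faces with `D` vertices) of `X` that are contained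
in a unique facet of `X`. -/
def boundary (D : ℕ) (X : PreAbstractSimplicialComplex V) : PreAbstractSimplicialComplex V :=
  generate {ρ | ρ ∈ X ∧ ρ.card = D ∧ ∃! σ, IsFacet X σ ∧ ρ ⊆ σ}

/-- An ordering `(v₀, …, v_d)` of the vertices of some `d`-dimensional face of `X`. -/
def IsOrderedFace (d : ℕ) (X : PreAbstractSimplicialComplex V) (v : Fin (d + 1) ↪ V) : Prop :=
  Finset.univ.map v ∈ X

/-- A choice of orientation for every `d`-dimensional face of `X`, given by the function that sends
an ordering `(v₀, …, v_d)` of the vertices of a face to `1` if the oriented simplex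
`⟨v₀, …, v_d⟩` is the chosen (positive) orientation of the face, and to `-1` if it is
the opposite one. Even permutations of the vertices keep the orientation and odd ones reverse it. -/
def IsOrientationChoice (d : ℕ) (X : PreAbstractSimplicialComplex V)
    (o : (Fin (d + 1) ↪ V) → ℤˣ) : Prop :=
  ∀ v, IsOrderedFace d X v → ∀ π : Equiv.Perm (Fin (d + 1)),
    o (π.toEmbedding.trans v) = Equiv.Perm.sign π * o v

/-- A choice of orientations is coherent if any two different `d`-dimensional faces that share a
`(d - 1)`-dimensional face induce opposite orientations on it. If the two faces are written as
`⟨v₀, …, vᵢ, …, v_d⟩` and `⟨v₀, …, wᵢ, …, v_d⟩` with the vertices of the common face in the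
same places, then both oriented simplices have the same incidence number `(-1)^i` with
`⟨v₀, …, vᵢ₋₁, vᵢ₊₁, …, v_d⟩`; so exactly one of them has to be positive. -/
def IsCoherent (d : ℕ) (X : PreAbstractSimplicialComplex V)
    (o : (Fin (d + 1) ↪ V) → ℤˣ) : Prop :=
  ∀ v w, IsOrderedFace d X v → IsOrderedFace d X w →
    ∀ i : Fin (d + 1), (∀ j, j ≠ i → v j = w j) → v i ≠ w i → o w = -o v

/-- A triangulated `d`-manifold is orientable if its `d`-dimensional faces can be oriented
coherently. -/
def Orientable (d : ℕ) (X : PreAbstractSimplicialComplex V) : Prop :=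
  ∃ o : (Fin (d + 1) ↪ V) → ℤˣ, IsOrientationChoice d X o ∧ IsCoherent d X o

/-- The number of vertices. -/
abbrev numVertices (d : ℕ) : ℕ := d ^ 2 + 5 * d + 5

/-- The vertex set `{a₀, …, a_{n-1}}`, with subscripts taken modulo `n = d² + 5d + 5`;
the vertex `a_i` is the residue class `i`. -/
abbrev Vertex (d : ℕ) : Type := ZMod (numVertices d)

/-- `σ_i = {a_{i-j} : 0 ≤ j ≤ d+1}`. -/
def sigmaFacet (d : ℕ) (i : Vertex d) : Finset (Vertex d) :=
  (Finset.Icc 0 (d + 1)).image fun j : ℕ => i - (j : Vertex d)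

/-- `μ_i = {a_i} ∪ {a_{i+j(d+3)-1} : 1 ≤ j ≤ d+1}`. -/
def muFacetM (d : ℕ) (i : Vertex d) : Finset (Vertex d) :=
  {i} ∪ (Finset.Icc 1 (d + 1)).image fun j : ℕ => i + ((j * (d + 3) : ℕ) : Vertex d) - 1

/-- `α_{k,i} = {a_i} ∪ {a_{i-j} : 2 ≤ j ≤ d+2-k} ∪ {a_{i+j(d+3)-1} : 1 ≤ j ≤ k}`. -/
def alphaFacetM (d k : ℕ) (i : Vertex d) : Finset (Vertex d) :=
  {i} ∪ ((Finset.Icc 2 (d + 2 - k)).image fun j : ℕ => i - (j : Vertex d)) ∪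
    (Finset.Icc 1 k).image fun j : ℕ => i + ((j * (d + 3) : ℕ) : Vertex d) - 1

/-- `μ_i = {a_{i-j(d+3)} : 0 ≤ j ≤ d+1}`. -/
def muFacetN (d : ℕ) (i : Vertex d) : Finset (Vertex d) :=
  (Finset.Icc 0 (d + 1)).image fun j : ℕ => i - ((j * (d + 3) : ℕ) : Vertex d)

/-- `α_{k,i} = {a_i} ∪ {a_{i-j} : 2 ≤ j ≤ d+2-k} ∪ {a_{i-j(d+3)} : 2 ≤ j ≤ k+1}`. -/
def alphaFacetN (d k : ℕ) (i : Vertex d) : Finset (Vertex d) :=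
  {i} ∪ ((Finset.Icc 2 (d + 2 - k)).image fun j : ℕ => i - (j : Vertex d)) ∪
    (Finset.Icc 2 (k + 1)).image fun j : ℕ => i - ((j * (d + 3) : ℕ) : Vertex d)

/-- The pure `(d+1)`-dimensional complex `𝓜_n^{d+1}` with facets `σ_i`, `μ_i`, `α_{k,i}`. -/
def solidM (d : ℕ) : PreAbstractSimplicialComplex (Vertex d) :=
  generate {ρ | ∃ i, ρ = sigmaFacet d i ∨ ρ = muFacetM d i ∨
    ∃ k, 1 ≤ k ∧ k ≤ d ∧ ρ = alphaFacetM d k i}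

/-- The pure `(d+1)`-dimensional complex `𝓝_n^{d+1}` with facets `σ_i`, `μ_i`, `α_{k,i}`. -/
def solidN (d : ℕ) : PreAbstractSimplicialComplex (Vertex d) :=
  generate {ρ | ∃ i, ρ = sigmaFacet d i ∨ ρ = muFacetN d i ∨
    ∃ k, 1 ≤ k ∧ k ≤ d ∧ ρ = alphaFacetN d k i}

/-- The triangulated `d`-manifold `M_n^d = ∂𝓜_n^{d+1}`. -/
def manifoldM (d : ℕ) : PreAbstractSimplicialComplex (Vertex d) := boundary (d + 1) (solidM d)

/-- The triangulated `d`-manifold `N_n^d = ∂𝓝_n^{d+1}`. -/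
def manifoldN (d : ℕ) : PreAbstractSimplicialComplex (Vertex d) := boundary (d + 1) (solidN d)

end SimplicialManifold

namespace SimplicialManifold

open Equiv

/-! Both families fit one scheme. Order `σ_i` as `i, i-1, …, i-(d+1)` and exchange its vertices one
by one, position `0` excepted, for multiples `i - m(d+3)`: the result after `k` exchanges is
`α_{k,i}`, and after `d+1` it is `μ_i`. The families differ only in the permutation `col` that
assigns `m` to each position. The dual graph consists of the cycle of the `σ_i` (`i ↦ i+1`), the
cycle of the `μ_i` (`i ↦ i+(d+3)`) and, for each `i`, a path from `σ_i` to `μ_i`.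

The facets through a fixed vertex form a tree in which each adds one vertex to its parent, all these
new vertices being different. Hence the facets containing any nonempty face are connected
(`reflTransGen_step`). So a codimension-one face lies in at most two facets (`card_star_le_two`),
and by counting incidences a codimension-two face lies in at most two boundary faces
(`card_star_insert`).

For even `d`, give the facet `(k,i)` the sign `(-1)^k` times its position order. Neighbours then
cancel on their common face: along the paths because `k` changes by one, along the cycles because a
rotation of `d+2` letters is odd. The boundary of this chain is `±1` on the boundary faces and `0`
elsewhere, and `∂∂ = 0` makes it a coherent orientation (`bd_eq_neg`).

For odd `d`, the boundary contains a strip of faces of the `σ_i` that reverses orientation at each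
step `i ↦ i+1`; it closes up after `n` steps, and `n` is odd. -/

/-! ### Arithmetic modulo `n` and the order of exchange. -/

theorem mul_step_eq_one (d : ℕ) : ((d : Vertex d) + 2) * (d + 3) = 1 := by
  have h : ((numVertices d : ℕ) : Vertex d) = 0 := ZMod.natCast_self _
  simp only [numVertices] at h
  push_cast at h
  linear_combination h

/-- The small integer relations between `1` and `d + 3` modulo `d² + 5d + 5`. -/
theorem exists_of_add_mul_eq_zero {d : ℕ} {a b : ℤ}
    (h : (a : Vertex d) + b * (d + 3) = 0) (ha : -(2 * d + 3) ≤ a) (ha' : a ≤ 2 * d + 3)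
    (hb : -(2 * d + 2) ≤ b) (hb' : b ≤ 2 * d + 2) :
    ∃ q r : ℤ, (q = -1 ∨ q = 0 ∨ q = 1) ∧ (r = -1 ∨ r = 0 ∨ r = 1) ∧
      a = r * (d + 3) - q ∧ b = q * (d + 2) - r := by
  have h1 : ((a + b * (d + 3) : ℤ) : Vertex d) = 0 := by push_cast; exact h
  rw [ZMod.intCast_zmod_eq_zero_iff_dvd] at h1
  obtain ⟨q, hq⟩ := h1
  simp only [numVertices] at hq
  push_cast at hq
  have hd0 : (0 : ℤ) ≤ d := Int.natCast_nonneg d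
  -- The allowed ranges give `|a + b(d+3)| ≤ 2d² + 10d + 9`, one less than `2n`.
  have hq1 : q < 2 := by
    by_contra hc
    nlinarith [mul_le_mul_of_nonneg_right hb' (show (0 : ℤ) ≤ d + 3 by positivity),
      mul_le_mul_of_nonneg_left (not_lt.1 hc) (show (0 : ℤ) ≤ (d : ℤ) ^ 2 + 5 * d + 5 by positivity)]
  have hq2 : -2 < q := by
    by_contra hc
    nlinarith [mul_le_mul_of_nonneg_right hb (show (0 : ℤ) ≤ d + 3 by positivity),
      mul_le_mul_of_nonneg_left (not_lt.1 hc) (show (0 : ℤ) ≤ (d : ℤ) ^ 2 + 5 * d + 5 by positivity)]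
  -- Since `n = (d+2)(d+3) - 1`, the vectors `(d+3, -1)` and `(-1, d+2)` span the relation lattice;
  -- `q` and `r` are coordinates in this basis.
  have hr : a + q = (q * (d + 2) - b) * (d + 3) := by linear_combination hq
  have hr1 : q * (d + 2) - b < 2 := by
    by_contra hc
    nlinarith [mul_le_mul_of_nonneg_right (not_lt.1 hc) (show (0 : ℤ) ≤ d + 3 by positivity)]
  have hr2 : -2 < q * (d + 2) - b := by
    by_contra hc
    nlinarith [mul_le_mul_of_nonneg_right (not_lt.1 hc) (show (0 : ℤ) ≤ d + 3 by positivity)]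
  exact ⟨q, q * (d + 2) - b, by omega, by omega, by linear_combination hr, by ring⟩

/-- The step at which the vertex in position `p` gets replaced on the way from `σ_i` to `μ_i`;
position `0` is never replaced. -/
def timeOf {d : ℕ} (p : Fin (d + 2)) : ℕ :=
  if p.1 = 0 then d + 2 else if p.1 = 1 then 1 else d + 3 - p.1

theorem timeOf_cases {d : ℕ} (p : Fin (d + 2)) :
    (p.1 = 0 ∧ timeOf p = d + 2) ∨ (p.1 = 1 ∧ timeOf p = 1) ∨
      (2 ≤ p.1 ∧ timeOf p + p.1 = d + 3) := by
  have := p.2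
  unfold timeOf
  split_ifs <;> omega

theorem exists_timeOf_eq {d k : ℕ} (h1 : 1 ≤ k) (h2 : k ≤ d + 1) :
    ∃ p : Fin (d + 2), timeOf p = k := by
  by_cases hk : k = 1
  · exact ⟨⟨1, by omega⟩, by simp [timeOf, hk]⟩
  · exact ⟨⟨d + 3 - k, by omega⟩, by unfold timeOf; dsimp only; split_ifs <;> omega⟩

theorem timeOf_injective {d : ℕ} {p q : Fin (d + 2)} (h : timeOf p = timeOf q) : p = q := by
  have := timeOf_cases p
  have := timeOf_cases q
  apply Fin.ext
  omega

/-! ### Schedules, facets and the dual graph. -/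

/-- The combinatorial data that distinguish the two families: the vertex `i - p` of `σ_i` gets
replaced by the vertex `i - (col p) (d + 3)` of `μ_i`. -/
structure Schedule (d : ℕ) where
  /-- the permutation of the positions -/
  col : Perm (Fin (d + 2))
  col_zero : ∀ p, p.1 = 0 → (col p).1 = 0
  -- Position `2` is exchanged last, so the multiple `1·(d+3)` enters only in `μ_i`.
  col_two : ∀ p, p.1 = 2 → (col p).1 = 1
  -- Exactly what keeps the new vertices of a path climbing from a `σ` and of one descending from a
  -- `μ` apart in `IsNew.unique`.
  le_timeOf_add : ∀ p q, (col p).1 + (col q).1 = d + 3 → d + 1 ≤ timeOf p + timeOf q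

namespace Schedule

variable {d : ℕ} (S : Schedule d)

theorem col_inj {p q : Fin (d + 2)} (h : (S.col p).1 = (S.col q).1) : p = q :=
  S.col.injective (Fin.ext h)

/-- The ordered vertices of the facet with index `(k, i)`. -/
def vert (A : ℕ × Vertex d) (p : Fin (d + 2)) : Vertex d :=
  if timeOf p ≤ A.1 then A.2 - ((S.col p).1 : Vertex d) * (d + 3) else A.2 - (p.1 : Vertex d)

theorem vert_of_le {A : ℕ × Vertex d} {p : Fin (d + 2)} (h : timeOf p ≤ A.1) :
    S.vert A p = A.2 - ((S.col p).1 : Vertex d) * (d + 3) := if_pos h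

theorem vert_of_lt {A : ℕ × Vertex d} {p : Fin (d + 2)} (h : A.1 < timeOf p) :
    S.vert A p = A.2 - (p.1 : Vertex d) := if_neg (not_le.2 h)

/-- A coincidence of two vertices would be a relation between `1` and `d+3`; every nonzero one has a
coefficient that is too large or of the wrong sign. -/
theorem vert_injective (A : ℕ × Vertex d) (hA : A.1 ≤ d + 1) :
    Function.Injective (S.vert A) := by
  have key : ∀ p q : Fin (d + 2), timeOf p ≤ A.1 → ¬ timeOf q ≤ A.1 →
      A.2 - ((S.col p).1 : Vertex d) * (d + 3) = A.2 - (q.1 : Vertex d) → False := by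
    intro p q hp hq h
    obtain ⟨x, y, hx, hy, h1, h2⟩ := exists_of_add_mul_eq_zero (d := d) (a := q.1)
      (b := -(S.col p).1) (by push_cast; linear_combination h) (by omega) (by omega) (by omega)
      (by omega)
    have := S.col_zero ⟨0, by omega⟩ rfl
    have hne : (S.col p).1 ≠ 0 := by
      intro h0
      have : p.1 = 0 := congrArg Fin.val (S.col_inj (h0.trans this.symm))
      have := timeOf_cases p
      omega
    rcases hx with rfl | rfl | rfl <;> rcases hy with rfl | rfl | rfl <;> omega
  intro p q h
  unfold vert at h
  split_ifs at h with hp hq hq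
  · obtain ⟨x, y, hx, hy, h1, h2⟩ := exists_of_add_mul_eq_zero (d := d) (a := 0)
      (b := (S.col p).1 - (S.col q).1) (by push_cast; linear_combination -h) (by omega) (by omega)
      (by omega) (by omega)
    apply S.col_inj
    rcases hx with rfl | rfl | rfl <;> rcases hy with rfl | rfl | rfl <;> omega
  · exact (key p q hp hq h).elim
  · exact (key q p hq hp h.symm).elim
  · obtain ⟨x, y, hx, hy, h1, h2⟩ := exists_of_add_mul_eq_zero (d := d) (b := 0)
      (a := (p.1 : ℤ) - q.1) (by push_cast; linear_combination -h) (by omega) (by omega)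
      (by omega) (by omega)
    apply Fin.ext
    rcases hx with rfl | rfl | rfl <;> rcases hy with rfl | rfl | rfl <;> omega

/-- The facet with index `(k, i)`: `σ_i` for `k = 0`, `α_{k,i}` for `1 ≤ k ≤ d` and `μ_i` for
`k = d + 1`. -/
def facet (A : ℕ × Vertex d) : Finset (Vertex d) := Finset.univ.image (S.vert A)

theorem mem_facet {A : ℕ × Vertex d} {x : Vertex d} : x ∈ S.facet A ↔ ∃ p, S.vert A p = x := by
  simp [facet]

theorem card_facet {A : ℕ × Vertex d} (hA : A.1 ≤ d + 1) : (S.facet A).card = d + 2 := by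
  rw [facet, Finset.card_image_of_injective _ (S.vert_injective A hA)]
  simp

/-- The facet `B` is obtained from the facet `A` by replacing the vertex in position `p`. -/
def Adj (A : ℕ × Vertex d) (p : Fin (d + 2)) (B : ℕ × Vertex d) : Prop :=
  (A.1 = 0 ∧ B.1 = 0 ∧ p.1 = d + 1 ∧ B.2 = A.2 + 1) ∨
  (A.1 = 0 ∧ B.1 = 0 ∧ p.1 = 0 ∧ B.2 = A.2 - 1) ∨
  (A.1 ≤ d ∧ B.1 = A.1 + 1 ∧ timeOf p = A.1 + 1 ∧ B.2 = A.2) ∨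
  (B.1 ≤ d ∧ A.1 = B.1 + 1 ∧ timeOf p = A.1 ∧ B.2 = A.2) ∨
  (A.1 = d + 1 ∧ B.1 = d + 1 ∧ (S.col p).1 = 0 ∧ B.2 = A.2 - (d + 3)) ∨
  (A.1 = d + 1 ∧ B.1 = d + 1 ∧ (S.col p).1 = d + 1 ∧ B.2 = A.2 + (d + 3))

theorem col_eq_zero_iff {p : Fin (d + 2)} : (S.col p).1 = 0 ↔ p.1 = 0 := by
  refine ⟨fun h => ?_, S.col_zero p⟩
  have := S.col_inj (h.trans (S.col_zero ⟨0, by omega⟩ rfl).symm)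
  rw [this]

theorem Adj.unique {S : Schedule d} (hd : 2 ≤ d) {A B B' : ℕ × Vertex d} {p : Fin (d + 2)}
    (h : S.Adj A p B) (h' : S.Adj A p B') : B = B' := by
  have hp := timeOf_cases p
  have hz := S.col_eq_zero_iff (p := p)
  have h2 := S.col_two p
  unfold Adj at h h'
  apply Prod.ext
  · omega
  rcases h with ⟨h, h1, h3, e⟩ | ⟨h, h1, h3, e⟩ | ⟨h, h1, h3, e⟩ | ⟨h, h1, h3, e⟩ | ⟨h, h1, h3, e⟩ |
    ⟨h, h1, h3, e⟩ <;>
  rcases h' with ⟨k, k1, k3, e'⟩ | ⟨k, k1, k3, e'⟩ | ⟨k, k1, k3, e'⟩ | ⟨k, k1, k3, e'⟩ |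
    ⟨k, k1, k3, e'⟩ | ⟨k, k1, k3, e'⟩ <;>
  first
  | exact e.trans e'.symm
  | (exfalso; omega)

theorem Adj.le {S : Schedule d} {A B : ℕ × Vertex d} {p : Fin (d + 2)} (h : S.Adj A p B) :
    A.1 ≤ d + 1 ∧ B.1 ≤ d + 1 := by
  unfold Adj at h
  omega

theorem vert_zero (i : Vertex d) (p : Fin (d + 2)) : S.vert (0, i) p = i - (p.1 : Vertex d) := by
  have := timeOf_cases p
  rw [vert, if_neg]
  dsimp only
  omega

theorem vert_last (i : Vertex d) (p : Fin (d + 2)) :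
    S.vert (d + 1, i) p = i - ((S.col p).1 : Vertex d) * (d + 3) := by
  have := timeOf_cases p
  unfold vert
  split_ifs with h
  · rfl
  · dsimp only at h ⊢
    have h0 : p.1 = 0 := by omega
    rw [h0, S.col_zero p h0]
    simp

/-- `B` arises from `A` by replacing the vertex in position `p`, with the vertices of the common
face matched by `π`. -/
structure Matches (A : ℕ × Vertex d) (p : Fin (d + 2)) (B : ℕ × Vertex d)
    (π : Perm (Fin (d + 2))) : Prop where
  vert_eq : ∀ q, q ≠ p → S.vert A q = S.vert B (π q)
  vert_ne : S.vert A p ≠ S.vert B (π p)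
  adj_symm : S.Adj B (π p) A
  -- The facet `(k, i)` is oriented by `(-1)^k` times its position order; this says that the
  -- orientations of `A` and `B` cancel on the common face.
  sign_eq : Even d → (-1 : ℤˣ) ^ B.1 * Perm.sign π = -(-1) ^ A.1

theorem finRotate_val (q : Fin (d + 2)) :
    (q.1 = d + 1 ∧ (finRotate (d + 2) q).1 = 0) ∨
      (q.1 < d + 1 ∧ (finRotate (d + 2) q).1 = q.1 + 1) := by
  rcases lt_or_eq_of_le (Nat.lt_succ_iff.1 q.2) with h | h
  · right
    refine ⟨h, ?_⟩
    rw [coe_finRotate_of_ne_last]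
    intro hq
    rw [hq] at h
    simp at h
  · left
    refine ⟨h, ?_⟩
    have : q = Fin.last (d + 1) := Fin.ext h
    rw [this, finRotate_last]
    rfl

theorem matches_sigma (i : Vertex d) (p : Fin (d + 2)) (hp : p.1 = d + 1) :
    S.Matches (0, i) p (0, i + 1) (finRotate (d + 2)) where
  vert_eq q hq := by
    have := finRotate_val q
    have hq' : q.1 ≠ d + 1 := fun h => hq (Fin.ext (h.trans hp.symm))
    rw [vert_zero, vert_zero]
    have h : (finRotate (d + 2) q).1 = q.1 + 1 := by omega
    rw [h]
    push_cast
    ring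
  vert_ne h := by
    rw [vert_zero, vert_zero] at h
    have h0 : (finRotate (d + 2) p).1 = 0 := by have := finRotate_val p; omega
    rw [h0, hp] at h
    obtain ⟨x, y, hx, hy, h1, h2⟩ := exists_of_add_mul_eq_zero (d := d) (a := d + 2)
      (b := 0) (by push_cast at h ⊢; linear_combination -h) (by omega) (by omega) (by omega)
      (by omega)
    rcases hx with rfl | rfl | rfl <;> rcases hy with rfl | rfl | rfl <;> omega
  adj_symm := by
    right; left
    have := finRotate_val p
    refine ⟨rfl, rfl, by omega, by simp⟩
  sign_eq h := by
    have h1 : Odd (d + 1) := h.add_one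
    simp [sign_finRotate, h1.neg_one_pow]

/-- Along the cycle of the `μ_i`, `col` plays the role of the position, so the matching is a
conjugate of the rotation and has the same sign. -/
theorem matches_mu (i : Vertex d) (p : Fin (d + 2)) (hp : (S.col p).1 = d + 1) :
    S.Matches (d + 1, i) p (d + 1, i + (d + 3)) (S.col.trans ((finRotate (d + 2)).trans S.col.symm))
    where
  vert_eq q hq := by
    have := finRotate_val (S.col q)
    have hq' : (S.col q).1 ≠ d + 1 := fun h => hq (S.col_inj (h.trans hp.symm))
    rw [vert_last, vert_last]
    have h : (finRotate (d + 2) (S.col q)).1 = (S.col q).1 + 1 := by omega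
    simp only [trans_apply, apply_symm_apply]
    rw [h]
    push_cast
    ring
  vert_ne h := by
    rw [vert_last, vert_last] at h
    simp only [trans_apply, apply_symm_apply] at h
    have h0 : (finRotate (d + 2) (S.col p)).1 = 0 := by
      have := finRotate_val (S.col p)
      omega
    rw [h0, hp] at h
    obtain ⟨x, y, hx, hy, h1, h2⟩ := exists_of_add_mul_eq_zero (d := d) (b := d + 2)
      (a := 0) (by push_cast at h ⊢; linear_combination -h) (by omega) (by omega) (by omega)
      (by omega)
    rcases hx with rfl | rfl | rfl <;> rcases hy with rfl | rfl | rfl <;> omega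
  adj_symm := by
    right; right; right; right; left
    have := finRotate_val (S.col p)
    refine ⟨rfl, rfl, ?_, by simp⟩
    simp only [trans_apply, apply_symm_apply]
    omega
  sign_eq h := by
    have h1 : Odd (d + 1) := h.add_one
    simp [sign_finRotate, h1.neg_one_pow, Perm.sign_trans, mul_comm]

theorem matches_alpha (k : ℕ) (hk : k ≤ d) (i : Vertex d) (p : Fin (d + 2))
    (hp : timeOf p = k + 1) : S.Matches (k, i) p (k + 1, i) 1 where
  vert_eq q hq := by
    have : timeOf q ≠ k + 1 := fun h => hq (timeOf_injective (h.trans hp.symm))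
    change S.vert (k, i) q = S.vert (k + 1, i) q
    by_cases hk : timeOf q ≤ k
    · rw [vert_of_le _ hk, vert_of_le _ (by dsimp only; omega)]
    · rw [vert_of_lt _ (not_le.1 hk), vert_of_lt _ (by dsimp only; omega)]
  vert_ne h := by
    change S.vert (k, i) p = S.vert (k + 1, i) p at h
    rw [vert_of_lt _ (by dsimp only; omega), vert_of_le _ (by dsimp only; omega)] at h
    have := timeOf_cases p
    have := S.col_eq_zero_iff (p := p)
    have := (S.col p).2
    obtain ⟨x, y, hx, hy, h1, h2⟩ := exists_of_add_mul_eq_zero (d := d) (b := (S.col p).1)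
      (a := - p.1) (by push_cast at h ⊢; linear_combination h) (by omega) (by omega) (by omega)
      (by omega)
    rcases hx with rfl | rfl | rfl <;> rcases hy with rfl | rfl | rfl <;> omega
  adj_symm := by
    right; right; right; left
    exact ⟨hk, rfl, hp, rfl⟩
  sign_eq h := by simp [pow_succ]

theorem Matches.symm {S : Schedule d} {A B : ℕ × Vertex d} {p : Fin (d + 2)}
    {π : Perm (Fin (d + 2))} (h : S.Matches A p B π) (hAB : S.Adj A p B) :
    S.Matches B (π p) A π⁻¹ where
  vert_eq q hq := by
    have := h.vert_eq (π⁻¹ q) (fun hc => hq (by rw [← hc]; simp))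
    rw [this]; simp
  vert_ne := by simpa using h.vert_ne.symm
  adj_symm := by simpa using hAB
  sign_eq hd := by
    have := h.sign_eq hd
    rw [Perm.sign_inv, ← neg_eq_iff_eq_neg.2 this]
    rw [neg_mul, mul_assoc, Int.units_mul_self, mul_one]

theorem Adj.exists_matches {S : Schedule d} {A B : ℕ × Vertex d} {p : Fin (d + 2)}
    (h : S.Adj A p B) : ∃ π, S.Matches A p B π := by
  obtain ⟨k, i⟩ := A
  obtain ⟨l, j⟩ := B
  have h' := h
  rcases h with ⟨h, h1, h3, e⟩ | ⟨h, h1, h3, e⟩ | ⟨h, h1, h3, e⟩ | ⟨h, h1, h3, e⟩ | ⟨h, h1, h3, e⟩ |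
    ⟨h, h1, h3, e⟩ <;> dsimp only at h h1 h3 e
  · subst h h1 e
    exact ⟨_, S.matches_sigma i p h3⟩
  · subst h h1
    obtain rfl : i = j + 1 := by rw [e]; ring
    have := (S.matches_sigma j (Fin.last _) rfl)
    have hp : finRotate (d + 2) (Fin.last _) = p := by rw [finRotate_last]; exact Fin.ext h3.symm
    have := this.symm (Or.inl ⟨rfl, rfl, rfl, rfl⟩)
    rw [hp] at this
    exact ⟨_, this⟩
  · subst h1 e
    exact ⟨_, S.matches_alpha k h _ p h3⟩
  · subst h1 e
    have := (S.matches_alpha l h j p h3).symm (Or.inr (Or.inr (Or.inl ⟨h, rfl, h3, rfl⟩)))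
    exact ⟨_, this⟩
  · subst h h1
    obtain rfl : i = j + (d + 3) := by rw [e]; ring
    obtain ⟨q, hq⟩ := S.col.surjective (Fin.last _)
    have hq1 : (S.col q).1 = d + 1 := by rw [hq]; rfl
    have := (S.matches_mu j q hq1).symm
      (Or.inr (Or.inr (Or.inr (Or.inr (Or.inr ⟨rfl, rfl, hq1, rfl⟩)))))
    have hp : (S.col.trans ((finRotate (d + 2)).trans S.col.symm)) q = p := by
      simp only [trans_apply, hq, finRotate_last]
      rw [symm_apply_eq]
      exact Fin.ext h3.symm
    rw [hp] at this
    exact ⟨_, this⟩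
  · subst h h1 e
    exact ⟨_, S.matches_mu i p h3⟩

end Schedule

/-! ### Connectedness in rooted trees of sets. -/

section Tree

variable {N V : Type*}

/-- In a rooted tree of sets in which every set has at most one element that is not in its parent
and these new elements are pairwise different, the sets containing a given set are connected. -/
theorem reflTransGen_of_new (root : N) (mem : N → Set V) (rk : N → ℕ) (par : N → N) (new : N → V)
    (hrk : ∀ x, x ≠ root → rk (par x) < rk x)
    (hnew : ∀ x, x ≠ root → mem x ⊆ insert (new x) (mem (par x)))
    (hinj : ∀ x y, x ≠ root → y ≠ root → new x = new y → x = y)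
    (hroot : ∀ x, x ≠ root → new x ∉ mem root)
    (τ : Set V) (x y : N) (hx : τ ⊆ mem x) (hy : τ ⊆ mem y) :
    Relation.ReflTransGen (fun a b => τ ⊆ mem a ∧ τ ⊆ mem b ∧
      ((a ≠ root ∧ par a = b) ∨ (b ≠ root ∧ par b = a))) x y := by
  set R := fun a b => τ ⊆ mem a ∧ τ ⊆ mem b ∧
      ((a ≠ root ∧ par a = b) ∨ (b ≠ root ∧ par b = a)) with hR
  have hsymm : ∀ a b, R a b → R b a := fun a b h => ⟨h.2.1, h.1, h.2.2.symm⟩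
  -- Climb while the parent still contains `τ`. The climb ends at the root or at a set whose new
  -- element lies in `τ`.
  have top : ∀ n x, rk x = n → τ ⊆ mem x → ∃ t, Relation.ReflTransGen R x t ∧ τ ⊆ mem t ∧
      (t = root ∨ (t ≠ root ∧ new t ∈ τ)) := by
    intro n
    induction n using Nat.strong_induction_on with
    | _ n ih =>
      intro x hn hx
      by_cases hr : x = root
      · exact ⟨x, .refl, hx, Or.inl hr⟩
      by_cases hp : τ ⊆ mem (par x)
      · obtain ⟨t, ht, h⟩ := ih (rk (par x)) (hn ▸ hrk x hr) (par x) rfl hp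
        exact ⟨t, .head ⟨hx, hp, Or.inl ⟨hr, rfl⟩⟩ ht, h⟩
      · obtain ⟨u, hu, hu'⟩ := Set.not_subset.1 hp
        rcases hnew x hr (hx hu) with h | h
        · exact ⟨x, .refl, hx, Or.inr ⟨hr, h ▸ hu⟩⟩
        · exact (hu' h).elim
  -- An element outside the root's set can only enter at the one node where it is new, so that node
  -- lies on the way from `y` to the root; only its rank is recorded.
  have anc : ∀ u n y, rk y = n → u ∈ mem y → u ∈ mem root ∨
      ∃ c, rk c ≤ rk y ∧ c ≠ root ∧ new c = u ∧ (rk c = rk y → c = y) := by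
    intro u n
    induction n using Nat.strong_induction_on with
    | _ n ih =>
      intro y hn hy
      by_cases hr : y = root
      · exact Or.inl (hr ▸ hy)
      rcases hnew y hr hy with h | h
      · exact Or.inr ⟨y, le_rfl, hr, h.symm, fun _ => rfl⟩
      · have hlt := hrk y hr
        rcases ih (rk (par y)) (hn ▸ hlt) (par y) rfl h with h | ⟨c, h1, h2, h3, -⟩
        · exact Or.inl h
        · exact Or.inr ⟨c, h1.trans hlt.le, h2, h3, fun h => by omega⟩
  have anc' : ∀ s t, s ≠ root → new s ∈ τ → τ ⊆ mem t → rk s ≤ rk t ∧ (rk s = rk t → s = t) := by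
    intro s t hs hsτ ht
    rcases anc _ _ t rfl (ht hsτ) with h | ⟨c, h1, h2, h3, h4⟩
    · exact (hroot s hs h).elim
    · rw [hinj c s h2 hs h3] at h1 h4
      exact ⟨h1, h4⟩
  obtain ⟨s, hxs, hs, hs'⟩ := top _ x rfl hx
  obtain ⟨t, hyt, ht, ht'⟩ := top _ y rfl hy
  -- Each top is bounded in rank by the other, hence they coincide.
  have hst : s = t := by
    rcases hs' with rfl | ⟨hs1, hs2⟩
    · rcases ht' with rfl | ⟨ht1, ht2⟩
      · rfl
      · exact (hroot t ht1 (hs ht2)).elim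
    · rcases ht' with rfl | ⟨ht1, ht2⟩
      · exact (hroot s hs1 (ht hs2)).elim
      · obtain ⟨h1, h2⟩ := anc' s t hs1 hs2 ht
        obtain ⟨h3, h4⟩ := anc' t s ht1 ht2 hs
        exact h2 (le_antisymm h1 h3)
  subst hst
  have : Std.Symm R := ⟨hsymm⟩
  exact hxs.trans (Std.Symm.symm _ _ hyt)

end Tree

/-! ### The tree of facets through a vertex. -/

namespace Schedule

variable {d : ℕ} (S : Schedule d)

/-- The facets that contain the vertex `v` are the `(k, v + offset k p)`, with `v` in position
`p`. -/
def offset (k : ℕ) (p : Fin (d + 2)) : Vertex d :=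
  if timeOf p ≤ k then ((S.col p).1 : Vertex d) * (d + 3) else (p.1 : Vertex d)

theorem vert_eq_iff {A : ℕ × Vertex d} {p : Fin (d + 2)} {v : Vertex d} :
    S.vert A p = v ↔ A = (A.1, v + S.offset A.1 p) := by
  obtain ⟨k, i⟩ := A
  unfold vert offset
  dsimp only
  rw [Prod.mk.injEq]
  split_ifs <;> simp [sub_eq_iff_eq_add]

/-- `a + b (d + 3)` is the vertex, relative to `v`, which the facet with `v` in position `p` has
and its parent in the tree of facets containing `v` has not. -/
def IsNew (k : ℕ) (p : Fin (d + 2)) (a b : ℤ) : Prop :=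
  -- The four kinds of edges: along the `σ`s, up a path from a `σ`, along the `μ`s, down a path from
  -- a `μ`.
  (k = 0 ∧ 1 ≤ p.1 ∧ a = p.1 ∧ b = 0) ∨
  (1 ≤ k ∧ k < timeOf p ∧ ∃ q : Fin (d + 2), timeOf q = k ∧ a = p.1 ∧ b = -(S.col q).1) ∨
  (k = d + 1 ∧ timeOf p ≤ k ∧ a = 0 ∧ b = (S.col p).1) ∨
  (k ≤ d ∧ timeOf p ≤ k ∧ ∃ q : Fin (d + 2), timeOf q = k + 1 ∧ a = -q.1 ∧ b = (S.col p).1)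

theorem col_eq_one_iff (hd : 2 ≤ d) {p : Fin (d + 2)} : (S.col p).1 = 1 ↔ p.1 = 2 := by
  refine ⟨fun h => ?_, S.col_two p⟩
  have := S.col_inj (h.trans (S.col_two ⟨2, by omega⟩ rfl).symm)
  rw [this]

variable {S}

theorem IsNew.bounds {k : ℕ} {p : Fin (d + 2)} {a b : ℤ} (h : S.IsNew k p a b) :
    -(d + 1 : ℤ) ≤ a ∧ a ≤ d + 1 ∧ -(d + 1 : ℤ) ≤ b ∧ b ≤ d + 1 := by
  rcases h with ⟨_, _, _, _⟩ | ⟨_, _, q, _, _, _⟩ | ⟨_, _, _, _⟩ | ⟨_, _, q, _, _, _⟩ <;> omega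

/-- Equal new vertices give a short relation, which `exists_of_add_mul_eq_zero` reduces to nine
candidates in each of the sixteen pairs of edge kinds. The delicate pairs match a descending edge
with one along the `σ`s, where `col_two` is needed, or with a climbing edge, where `le_timeOf_add`
is. -/
theorem IsNew.unique (hd : 2 ≤ d) {k k' : ℕ} {p p' : Fin (d + 2)} {a b a' b' : ℤ}
    (hk : k ≤ d + 1) (hk' : k' ≤ d + 1) (h : S.IsNew k p a b)
    (h' : S.IsNew k' p' a' b')
    (e : (a : Vertex d) + b * (d + 3) = a' + b' * (d + 3)) : k = k' ∧ p = p' := by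
  have k1 := h.bounds
  have k2 := h'.bounds
  obtain ⟨x, y, hx, hy, h1, h2⟩ := exists_of_add_mul_eq_zero (d := d) (a := a - a')
      (b := b - b') (by push_cast; linear_combination e) (by omega) (by omega) (by omega)
      (by omega)
  clear e k1 k2
  rw [Fin.ext_iff]
  have c0 := fun q => S.col_eq_zero_iff (p := q)
  have c1 := fun q => S.col_eq_one_iff hd (p := q)
  have t0 := fun q : Fin (d + 2) => timeOf_cases q
  have cp : (S.col p).1 = (S.col p').1 → p.1 = p'.1 := fun h => by rw [S.col_inj h]
  rcases h with ⟨j1, j2, j3, j4⟩ | ⟨j1, j2, q, j3, j4, j5⟩ | ⟨j1, j2, j3, j4⟩ |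
    ⟨j1, j2, q, j3, j4, j5⟩ <;>
  rcases h' with ⟨l1, l2, l3, l4⟩ | ⟨l1, l2, q', l3, l4, l5⟩ | ⟨l1, l2, l3, l4⟩ |
    ⟨l1, l2, q', l3, l4, l5⟩
  · clear c0 c1 t0 cp
    rcases hx with rfl | rfl | rfl <;> rcases hy with rfl | rfl | rfl <;> omega
  · have g0 := c1 q'
    have g1 := c0 q'
    have g2 := t0 q'
    have g3 := t0 p'
    clear c0 c1 t0 cp
    rcases hx with rfl | rfl | rfl <;> rcases hy with rfl | rfl | rfl <;> omega
  · have g0 := c0 p'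
    have g1 := t0 p'
    clear c0 c1 t0 cp
    rcases hx with rfl | rfl | rfl <;> rcases hy with rfl | rfl | rfl <;> omega
  · have g0 := c0 p'
    have g1 := c1 p'
    have g2 := t0 p'
    have g3 := t0 q'
    clear c0 c1 t0 cp
    rcases hx with rfl | rfl | rfl <;> rcases hy with rfl | rfl | rfl <;> omega
  · have g0 := c1 q
    have g1 := c0 q
    have g2 := t0 q
    have g3 := t0 p
    clear c0 c1 t0 cp
    rcases hx with rfl | rfl | rfl <;> rcases hy with rfl | rfl | rfl <;> omega
  · have g0 := (fun h : (S.col q).1 = (S.col q').1 => congrArg timeOf (S.col_inj h))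
    clear c0 c1 t0 cp
    rcases hx with rfl | rfl | rfl <;> rcases hy with rfl | rfl | rfl <;> omega
  · have g0 := t0 p
    have g1 := t0 p'
    have g2 := c0 p'
    have g3 := c0 q
    have g4 := t0 q
    clear c0 c1 t0 cp
    rcases hx with rfl | rfl | rfl <;> rcases hy with rfl | rfl | rfl <;> omega
  -- The critical relation is `p + q' = d + 4`, `col q + col p' = d + 3`. Then the times of `p` and
  -- `q'` add up to `d + 2`, so those of `q` and `p'`, strictly smaller, add up to at most `d`.
  · have g0 := S.le_timeOf_add q p'
    have g1 := t0 p
    have g2 := t0 q'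
    have g3 := t0 p'
    have g4 := c0 p'
    have g5 := c0 q
    have g6 := t0 q
    clear c0 c1 t0 cp
    rcases hx with rfl | rfl | rfl <;> rcases hy with rfl | rfl | rfl <;> omega
  · have g0 := c0 p
    have g1 := t0 p
    clear c0 c1 t0 cp
    rcases hx with rfl | rfl | rfl <;> rcases hy with rfl | rfl | rfl <;> omega
  · have g0 := t0 p'
    have g1 := t0 p
    have g2 := c0 p
    have g3 := c0 q'
    have g4 := t0 q'
    clear c0 c1 t0 cp
    rcases hx with rfl | rfl | rfl <;> rcases hy with rfl | rfl | rfl <;> omega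
  · have g0 := cp
    clear c0 c1 t0 cp
    rcases hx with rfl | rfl | rfl <;> rcases hy with rfl | rfl | rfl <;> omega
  · have g0 := c0 p
    have g1 := t0 p
    have g2 := t0 q'
    clear c0 c1 t0 cp
    rcases hx with rfl | rfl | rfl <;> rcases hy with rfl | rfl | rfl <;> omega
  · have g0 := c0 p
    have g1 := c1 p
    have g2 := t0 p
    have g3 := t0 q
    clear c0 c1 t0 cp
    rcases hx with rfl | rfl | rfl <;> rcases hy with rfl | rfl | rfl <;> omega
  · have g0 := S.le_timeOf_add p q'
    have g1 := t0 p'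
    have g2 := t0 q
    have g3 := t0 p
    have g4 := c0 p
    have g5 := c0 q'
    have g6 := t0 q'
    clear c0 c1 t0 cp
    rcases hx with rfl | rfl | rfl <;> rcases hy with rfl | rfl | rfl <;> omega
  · have g0 := c0 p'
    have g1 := t0 p'
    have g2 := t0 q
    clear c0 c1 t0 cp
    rcases hx with rfl | rfl | rfl <;> rcases hy with rfl | rfl | rfl <;> omega
  · have g0 := cp
    have g1 := t0 q
    have g2 := t0 q'
    clear c0 c1 t0 cp
    rcases hx with rfl | rfl | rfl <;> rcases hy with rfl | rfl | rfl <;> omega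

theorem IsNew.ne_root (hd : 2 ≤ d) {k : ℕ} {p r : Fin (d + 2)} {a b : ℤ}
    (hk : k ≤ d + 1) (h : S.IsNew k p a b) : (a : Vertex d) + b * (d + 3) ≠ -(r.1 : Vertex d) := by
  intro e
  have k1 := h.bounds
  obtain ⟨x, y, hx, hy, h1, h2⟩ := exists_of_add_mul_eq_zero (d := d) (a := a + r.1)
      (b := b) (by push_cast; linear_combination e) (by omega) (by omega) (by omega)
      (by omega)
  clear e k1
  have f1 := timeOf_cases p
  have f3 := S.col_eq_zero_iff (p := p)
  rcases h with ⟨_, _, _, _⟩ | ⟨_, _, q, _, _, _⟩ | ⟨_, _, _, _⟩ | ⟨_, _, q, _, _, _⟩ <;>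
  try have g1 := timeOf_cases q
  all_goals try have g3 := S.col_eq_one_iff hd (p := q)
  all_goals try have g8 := S.col_eq_zero_iff (p := q)
  all_goals rcases hx with rfl | rfl | rfl <;> rcases hy with rfl | rfl | rfl
  all_goals omega

variable (S)

/-- Every facet containing `v`, except the one at the root, has a parent. -/
theorem exists_parent (v : Vertex d) (k : ℕ) (hk : k ≤ d + 1) (p : Fin (d + 2))
    (hkp : ¬ (k = 0 ∧ p.1 = 0)) : ∃ (k' : ℕ) (p' r : Fin (d + 2)) (a b : ℤ), k' ≤ d + 1 ∧
      -- The rank is the distance from the root `σ_v`: `p` steps along the `σ`s and `k` up; or `d+1`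
      -- up to `μ_v`, `col p` along the `μ`s and `d+1-k` down.
      (if timeOf p' ≤ k' then d + 1 + (S.col p').1 + (d + 1 - k') else p'.1 + k') <
        (if timeOf p ≤ k then d + 1 + (S.col p).1 + (d + 1 - k) else p.1 + k) ∧
      S.Adj (k, v + S.offset k p) r (k', v + S.offset k' p') ∧
      S.IsNew k p a b ∧ S.vert (k, v + S.offset k p) r = v + (a + b * (d + 3)) := by
  have f1 := timeOf_cases p
  have f3 := S.col_eq_zero_iff (p := p)
  have z : timeOf (⟨0, by omega⟩ : Fin (d + 2)) = d + 2 := by simp [timeOf]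
  by_cases hpk : timeOf p ≤ k
  · by_cases hkd : k = d + 1
    · obtain ⟨p', hp'⟩ := S.col.surjective ⟨(S.col p).1 - 1, by omega⟩
      have hp1 : (S.col p').1 + 1 = (S.col p).1 := by rw [hp']; dsimp only; omega
      have g1 := timeOf_cases p'
      have g3 := S.col_eq_zero_iff (p := p')
      have hc := S.col_zero ⟨0, by omega⟩ rfl
      have ho : S.offset (d + 1) p' = ((S.col p').1 : Vertex d) * (d + 3) := by
        unfold offset
        split_ifs
        · rfl
        · have h0 : p'.1 = 0 := by omega
          simp [h0, g3.2 h0]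
      refine ⟨d + 1, p', ⟨0, by omega⟩, 0, (S.col p).1, le_rfl, ?_, ?_, ?_, ?_⟩
      · rw [if_pos hpk]
        split_ifs <;> omega
      · right; right; right; right; left
        refine ⟨hkd, rfl, hc, ?_⟩
        dsimp only
        rw [ho, offset, if_pos hpk, ← hp1]
        push_cast
        ring
      · exact Or.inr (Or.inr (Or.inl ⟨hkd, hpk, rfl, rfl⟩))
      · rw [vert_of_lt _ (by dsimp only; omega), offset, if_pos hpk]
        push_cast
        ring
    · obtain ⟨q, hq⟩ := exists_timeOf_eq (d := d) (k := k + 1) (by omega) (by omega)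
      refine ⟨k + 1, p, q, -q.1, (S.col p).1, by omega, ?_, ?_, ?_, ?_⟩
      · rw [if_pos hpk, if_pos (by omega)]
        omega
      · right; right; left
        refine ⟨by dsimp only; omega, rfl, hq, ?_⟩
        dsimp only
        rw [offset, offset, if_pos hpk, if_pos (by omega)]
      · exact Or.inr (Or.inr (Or.inr ⟨by omega, hpk, q, hq, rfl, rfl⟩))
      · rw [vert_of_lt _ (by dsimp only; omega), offset, if_pos hpk]
        push_cast
        ring
  · by_cases hk0 : k = 0
    · have g1 := timeOf_cases (⟨p.1 - 1, by omega⟩ : Fin (d + 2))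
      dsimp only at g1
      refine ⟨0, ⟨p.1 - 1, by omega⟩, ⟨0, by omega⟩, p.1, 0, by omega, ?_, ?_, ?_, ?_⟩
      · rw [if_neg hpk, if_neg (by omega)]
        dsimp only
        omega
      · right; left
        refine ⟨hk0, rfl, rfl, ?_⟩
        dsimp only
        rw [offset, offset, if_neg hpk, if_neg (by omega), Nat.cast_sub (by omega)]
        push_cast
        ring
      · exact Or.inl ⟨hk0, by omega, rfl, rfl⟩
      · rw [vert_of_lt _ (by dsimp only; omega), offset, if_neg hpk]
        push_cast
        ring
    · obtain ⟨q, hq⟩ := exists_timeOf_eq (d := d) (k := k) (by omega) (by omega)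
      refine ⟨k - 1, p, q, p.1, -(S.col q).1, by omega, ?_, ?_, ?_, ?_⟩
      · rw [if_neg hpk, if_neg (by omega)]
        omega
      · right; right; right; left
        refine ⟨by dsimp only; omega, by dsimp only; omega, hq, ?_⟩
        dsimp only
        rw [offset, offset, if_neg hpk, if_neg (by omega)]
      · exact Or.inr (Or.inl ⟨by omega, by omega, q, hq, rfl, rfl⟩)
      · rw [vert_of_le _ (by dsimp only; omega), offset, if_neg hpk]
        push_cast
        ring

/-- Neighbouring facets, both containing `τ`. -/
def Step (τ : Finset (Vertex d)) (A B : ℕ × Vertex d) : Prop :=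
  τ ⊆ S.facet A ∧ τ ⊆ S.facet B ∧ ∃ p, S.Adj A p B

theorem Adj.subset {S : Schedule d} {A B : ℕ × Vertex d} {p : Fin (d + 2)} (h : S.Adj A p B) :
    S.facet A ⊆ insert (S.vert A p) (S.facet B) := by
  obtain ⟨π, hπ⟩ := h.exists_matches
  intro x hx
  obtain ⟨q, rfl⟩ := S.mem_facet.1 hx
  by_cases hq : q = p
  · rw [hq]; exact Finset.mem_insert_self _ _
  · rw [hπ.vert_eq q hq]
    exact Finset.mem_insert_of_mem (S.mem_facet.2 ⟨_, rfl⟩)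

theorem Adj.symm {S : Schedule d} {A B : ℕ × Vertex d} {p : Fin (d + 2)} (h : S.Adj A p B) :
    ∃ q, S.Adj B q A := by
  obtain ⟨π, hπ⟩ := h.exists_matches
  exact ⟨_, hπ.adj_symm⟩

/-- The facets containing a nonempty set of vertices are connected through neighbours. -/
theorem reflTransGen_step (hd : 2 ≤ d) {τ : Finset (Vertex d)} (hτ : τ.Nonempty)
    {A B : ℕ × Vertex d} (hA : A.1 ≤ d + 1) (hB : B.1 ≤ d + 1) (hτA : τ ⊆ S.facet A)
    (hτB : τ ⊆ S.facet B) : Relation.ReflTransGen (S.Step τ) A B := by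
  obtain ⟨v, hv⟩ := hτ
  obtain ⟨p, hp⟩ := S.mem_facet.1 (hτA hv)
  obtain ⟨q, hq⟩ := S.mem_facet.1 (hτB hv)
  rw [vert_eq_iff] at hp hq
  set root : Fin (d + 2) × Fin (d + 2) := (0, 0) with hroot
  have ex : ∀ x : Fin (d + 2) × Fin (d + 2), x ≠ root → ∃ (y : Fin (d + 2) × Fin (d + 2))
      (r : Fin (d + 2)) (a b : ℤ),
      (if timeOf y.2 ≤ y.1.1 then d + 1 + (S.col y.2).1 + (d + 1 - y.1.1) else y.2.1 + y.1.1) <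
        (if timeOf x.2 ≤ x.1.1 then d + 1 + (S.col x.2).1 + (d + 1 - x.1.1) else x.2.1 + x.1.1) ∧
      S.Adj (x.1.1, v + S.offset x.1.1 x.2) r (y.1.1, v + S.offset y.1.1 y.2) ∧
      S.IsNew x.1.1 x.2 a b ∧
      S.vert (x.1.1, v + S.offset x.1.1 x.2) r = v + (a + b * (d + 3)) := by
    rintro ⟨k, p⟩ hx
    obtain ⟨k', p', r, a, b, hk', h⟩ := S.exists_parent v k.1 (by omega) p
      (fun h => hx (Prod.ext (Fin.ext h.1) (Fin.ext h.2)))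
    exact ⟨(⟨k', by omega⟩, p'), r, a, b, h⟩
  have ex' : ∀ x : Fin (d + 2) × Fin (d + 2), ∃ (y : Fin (d + 2) × Fin (d + 2))
      (r : Fin (d + 2)) (a b : ℤ), x ≠ root →
      (if timeOf y.2 ≤ y.1.1 then d + 1 + (S.col y.2).1 + (d + 1 - y.1.1) else y.2.1 + y.1.1) <
        (if timeOf x.2 ≤ x.1.1 then d + 1 + (S.col x.2).1 + (d + 1 - x.1.1) else x.2.1 + x.1.1) ∧
      S.Adj (x.1.1, v + S.offset x.1.1 x.2) r (y.1.1, v + S.offset y.1.1 y.2) ∧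
      S.IsNew x.1.1 x.2 a b ∧
      S.vert (x.1.1, v + S.offset x.1.1 x.2) r = v + (a + b * (d + 3)) := by
    intro x
    by_cases hx : x = root
    · exact ⟨x, 0, 0, 0, fun h => (h hx).elim⟩
    · obtain ⟨y, r, a, b, h⟩ := ex x hx
      exact ⟨y, r, a, b, fun _ => h⟩
  choose par r a b hpar using ex'
  have h := reflTransGen_of_new root
    (fun x => (S.facet (x.1.1, v + S.offset x.1.1 x.2) : Set (Vertex d)))
    (fun x => if timeOf x.2 ≤ x.1.1 then d + 1 + (S.col x.2).1 + (d + 1 - x.1.1)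
      else x.2.1 + x.1.1) par
    (fun x => S.vert (x.1.1, v + S.offset x.1.1 x.2) (r x))
    (fun x hx => (hpar x hx).1)
    (fun x hx => by exact_mod_cast (hpar x hx).2.1.subset)
    (fun x y hx hy hxy => by
      obtain ⟨-, -, h1, h2⟩ := hpar x hx
      obtain ⟨-, -, h3, h4⟩ := hpar y hy
      rw [h2, h4] at hxy
      obtain ⟨h5, h6⟩ := h1.unique hd (by omega) (by omega) h3 (add_left_cancel hxy)
      exact Prod.ext (Fin.ext h5) h6)
    (fun x hx hmem => by
      obtain ⟨-, -, h1, h2⟩ := hpar x hx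
      have h0 : S.offset 0 0 = 0 := by simp [offset, timeOf]
      rw [h2, Finset.mem_coe, mem_facet] at hmem
      obtain ⟨q, hq⟩ := hmem
      rw [hroot] at hq
      dsimp only [Fin.val_zero] at hq
      rw [h0, vert_zero] at hq
      exact h1.ne_root hd (r := q) (by omega) (by linear_combination -hq))
    (τ : Set (Vertex d)) (⟨A.1, by omega⟩, p) (⟨B.1, by omega⟩, q)
    (by dsimp only; rw [← hp]; exact_mod_cast hτA) (by dsimp only; rw [← hq]; exact_mod_cast hτB)
  have h' := h.lift (p := S.Step τ)
    (fun x : Fin (d + 2) × Fin (d + 2) => (x.1.1, v + S.offset x.1.1 x.2)) (fun x y hxy => by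
      obtain ⟨h1, h2, h3⟩ := hxy
      refine ⟨by exact_mod_cast h1, by exact_mod_cast h2, ?_⟩
      rcases h3 with ⟨h3, rfl⟩ | ⟨h3, rfl⟩
      · exact ⟨_, (hpar x h3).2.1⟩
      · exact (hpar y h3).2.1.symm)
  change Relation.ReflTransGen (S.Step τ) (A.1, v + S.offset A.1 p) (B.1, v + S.offset B.1 q) at h'
  rwa [← hp, ← hq] at h'

end Schedule

/-! ### Counting facets around a face. -/

instance neZero_numVertices (d : ℕ) : NeZero (numVertices d) := ⟨by simp [numVertices]⟩

/-- A finite family of `m`-element sets, connected through steps that add at most one element, has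
at most `m - 1` elements more than members. -/
theorem card_biUnion_le_of_connected {ι V : Type*} [DecidableEq ι] [DecidableEq V] (T : Finset ι)
    (f : ι → Finset V) (m : ℕ) (R : ι → ι → Prop) (hT : T.Nonempty)
    (hmem : ∀ a b, R a b → b ∈ T)
    (hconn : ∀ a ∈ T, ∀ b ∈ T, Relation.ReflTransGen R a b)
    (hR : ∀ a b, R a b → ∃ x, f b ⊆ insert x (f a)) (hm : ∀ a ∈ T, (f a).card ≤ m) :
    (T.biUnion f).card + 1 ≤ m + T.card := by
  obtain ⟨a, ha⟩ := hT
  -- Take a largest subfamily containing `a` that obeys the bound. A step leaving it would add one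
  -- member and at most one element, giving a larger one.
  obtain ⟨U, hU, hmax⟩ := Finset.exists_max_image
    (T.powerset.filter fun U => a ∈ U ∧ (U.biUnion f).card + 1 ≤ m + U.card) Finset.card
    ⟨{a}, by simpa [ha] using hm a ha⟩
  simp only [Finset.mem_filter, Finset.mem_powerset] at hU hmax
  obtain ⟨hUT, haU, hU⟩ := hU
  suffices h : U = T from h ▸ hU
  refine hUT.antisymm fun b hb => ?_
  induction hconn a ha b hb with
  | refl => exact haU
  | tail _ hxy ih =>
    rename_i x y hax
    by_contra hy
    have hxU := ih (by
      rcases Relation.ReflTransGen.cases_tail hax with h | ⟨c, -, h⟩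
      · rw [h]; exact ha
      · exact hmem _ _ h)
    obtain ⟨z, hz⟩ := hR _ _ hxy
    have h1 : (insert y U).biUnion f ⊆ insert z (U.biUnion f) := by
      rw [Finset.biUnion_insert]
      refine Finset.union_subset (hz.trans ?_) (Finset.subset_insert _ _)
      exact Finset.insert_subset_insert _ (Finset.subset_biUnion_of_mem f hxU)
    have h2 := (Finset.card_le_card h1).trans (Finset.card_insert_le _ _)
    have h3 := Finset.card_insert_of_notMem hy
    have := hmax (insert y U) ⟨Finset.insert_subset (hmem _ _ hxy) hUT,
      Finset.mem_insert_of_mem haU, by omega⟩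
    omega

namespace Schedule

variable {d : ℕ} (S : Schedule d)

theorem Adj.vert_notMem {S : Schedule d} {A B : ℕ × Vertex d} {p : Fin (d + 2)}
    (h : S.Adj A p B) : S.vert A p ∉ S.facet B := by
  obtain ⟨π, hπ⟩ := h.exists_matches
  intro hm
  obtain ⟨q, hq⟩ := S.mem_facet.1 hm
  obtain ⟨r, rfl⟩ := π.surjective q
  by_cases hr : r = p
  · subst hr
    exact hπ.vert_ne hq.symm
  · rw [← hπ.vert_eq r hr] at hq
    exact hr (S.vert_injective A h.le.1 hq)

/-- A facet of codimension one of the facet `A` lies in at most one other facet, the neighbour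
through it. -/
theorem adj_of_forall_mem (hd : 2 ≤ d) {A B : ℕ × Vertex d} {p : Fin (d + 2)} (hA : A.1 ≤ d + 1)
    (hB : B.1 ≤ d + 1) (hAB : B ≠ A) (h : ∀ q, q ≠ p → S.vert A q ∈ S.facet B) :
    S.Adj A p B := by
  set ρ := (S.facet A).erase (S.vert A p) with hρ
  have mem_ρ : ∀ q, q ≠ p → S.vert A q ∈ ρ := fun q hq =>
    Finset.mem_erase.2 ⟨fun hc => hq (S.vert_injective A hA hc), S.mem_facet.2 ⟨q, rfl⟩⟩
  have hne : ρ.Nonempty := by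
    obtain ⟨q, hq⟩ := exists_ne p
    exact ⟨_, mem_ρ q hq⟩
  have hρB : ρ ⊆ S.facet B := by
    intro x hx
    obtain ⟨hx1, hx2⟩ := Finset.mem_erase.1 hx
    obtain ⟨q, rfl⟩ := S.mem_facet.1 hx2
    exact h q fun hq => hx1 (by rw [hq])
  have hconn := S.reflTransGen_step hd hne hA hB (Finset.erase_subset _ _) hρB
  suffices B = A ∨ S.Adj A p B from this.resolve_left hAB
  clear h hAB hB hρB
  -- Follow a walk from `A` through facets containing `ρ`: any exit from `A` other than `p` loses a
  -- vertex of `ρ`, and the neighbour through `p` can only be left back to `A`. The walk never gets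
  -- further.
  induction hconn with
  | refl => exact Or.inl rfl
  | tail _ hXY ih =>
    rename_i X Y _
    obtain ⟨-, hY, r, hr⟩ := hXY
    rcases ih with rfl | hX
    · right
      by_cases hrp : r = p
      · rwa [hrp] at hr
      · exact (hr.vert_notMem (hY (mem_ρ r hrp))).elim
    · left
      obtain ⟨π, hπ⟩ := hX.exists_matches
      obtain ⟨q, rfl⟩ := π.surjective r
      by_cases hqp : q = p
      · rw [hqp] at hr
        exact hr.unique hd hπ.adj_symm
      · have := hY (mem_ρ q hqp)
        rw [hπ.vert_eq q hqp] at this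
        exact (hr.vert_notMem this).elim

theorem facet_injective (hd : 2 ≤ d) {A B : ℕ × Vertex d} (hA : A.1 ≤ d + 1) (hB : B.1 ≤ d + 1)
    (h : S.facet A = S.facet B) : A = B := by
  by_contra hne
  have hm : ∀ q, S.vert A q ∈ S.facet B := fun q => h ▸ S.mem_facet.2 ⟨q, rfl⟩
  exact (S.adj_of_forall_mem hd (p := 0) hA hB (Ne.symm hne) fun q _ => hm q).vert_notMem (hm 0)

/-- The indices of all facets that contain `τ`. -/
def star (τ : Finset (Vertex d)) : Finset (ℕ × Vertex d) :=
  (Finset.range (d + 2) ×ˢ Finset.univ).filter fun A => τ ⊆ S.facet A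

theorem mem_star {τ : Finset (Vertex d)} {A : ℕ × Vertex d} :
    A ∈ S.star τ ↔ A.1 ≤ d + 1 ∧ τ ⊆ S.facet A := by
  simp [star, Nat.lt_succ_iff]

theorem exists_position {ρ : Finset (Vertex d)} (hρ : ρ.card = d + 1) {A : ℕ × Vertex d}
    (hA : A ∈ S.star ρ) : ∃ p, ρ = (S.facet A).erase (S.vert A p) := by
  obtain ⟨hA1, hA2⟩ := S.mem_star.1 hA
  have hc := S.card_facet hA1
  obtain ⟨x, hx⟩ := Finset.card_eq_one.1 (show (S.facet A \ ρ).card = 1 by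
    rw [Finset.card_sdiff_of_subset hA2]; omega)
  have hxA : x ∈ S.facet A \ ρ := hx ▸ Finset.mem_singleton_self x
  rw [Finset.mem_sdiff] at hxA
  obtain ⟨p, rfl⟩ := S.mem_facet.1 hxA.1
  refine ⟨p, Finset.eq_of_subset_of_card_le ?_ ?_⟩
  · exact fun y hy => Finset.mem_erase.2 ⟨fun h => hxA.2 (h ▸ hy), hA2 hy⟩
  · rw [Finset.card_erase_of_mem hxA.1]; omega

theorem exists_adj_of_mem_star (hd : 2 ≤ d) {ρ : Finset (Vertex d)} (hρ : ρ.card = d + 1)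
    {A : ℕ × Vertex d} (hA : A ∈ S.star ρ) :
    ∃ p, ρ = (S.facet A).erase (S.vert A p) ∧ ∀ B ∈ S.star ρ, B ≠ A → S.Adj A p B := by
  obtain ⟨p, hp⟩ := S.exists_position hρ hA
  refine ⟨p, hp, fun B hB hBA => ?_⟩
  have hA' := (S.mem_star.1 hA).1
  obtain ⟨hB1, hB2⟩ := S.mem_star.1 hB
  refine S.adj_of_forall_mem hd hA' hB1 hBA fun q hq => hB2 ?_
  rw [hp]
  exact Finset.mem_erase.2 ⟨fun h => hq (S.vert_injective A hA' h), S.mem_facet.2 ⟨q, rfl⟩⟩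

theorem card_star_le_two (hd : 2 ≤ d) {ρ : Finset (Vertex d)} (hρ : ρ.card = d + 1) :
    (S.star ρ).card ≤ 2 := by
  by_contra! h
  obtain ⟨A, hA, B, hB, C, hC, hAB, hAC, hBC⟩ := Finset.two_lt_card.1 h
  obtain ⟨p, -, hp⟩ := S.exists_adj_of_mem_star hd hρ hA
  exact hBC ((hp B hB (Ne.symm hAB)).unique hd (hp C hC (Ne.symm hAC)))

/-- A face of codimension two lies in at most two faces of codimension one that belong to only
one facet. -/
theorem card_star_insert (hd : 2 ≤ d) {τ : Finset (Vertex d)} (hτ : τ.card = d)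
    {x y z : Vertex d} (hxy : x ≠ y) (hzx : z ≠ x) (hzy : z ≠ y) (hx : x ∉ τ) (hy : y ∉ τ)
    (hz : z ∉ τ) (hx1 : (S.star (insert x τ)).card = 1) (hy1 : (S.star (insert y τ)).card = 1) :
    (S.star (insert z τ)).card ≠ 1 := by
  intro hz1
  set T := S.star τ with hT
  have hfil : ∀ u, S.star (insert u τ) = T.filter fun A => u ∈ S.facet A := by
    intro u
    ext A
    rw [Finset.mem_filter, hT, mem_star, mem_star, Finset.insert_subset_iff]
    tauto
  have hne : τ.Nonempty := Finset.card_pos.1 (by omega)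
  set W := T.biUnion S.facet with hW
  have hpos : ∀ u, (S.star (insert u τ)).card = 1 → u ∈ W ∧ T.Nonempty := by
    intro u hu
    obtain ⟨A, hA⟩ := Finset.card_pos.1 (by omega : 0 < (S.star (insert u τ)).card)
    rw [hfil, Finset.mem_filter] at hA
    exact ⟨Finset.mem_biUnion.2 ⟨A, hA.1, hA.2⟩, A, hA.1⟩
  have hTne := (hpos x hx1).2
  have hcard : W.card + 1 ≤ d + 2 + T.card := by
    refine card_biUnion_le_of_connected T S.facet (d + 2)
      (fun A B => S.Step τ A B) hTne ?_ ?_ ?_ ?_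
    · rintro A B ⟨-, h, p, hp⟩
      exact S.mem_star.2 ⟨hp.le.2, h⟩
    · intro A hA B hB
      rw [mem_star] at hA hB
      exact S.reflTransGen_step hd hne hA.1 hB.1 hA.2 hB.2
    · rintro A B ⟨-, -, p, hp⟩
      obtain ⟨q, hq⟩ := hp.symm
      exact ⟨_, hq.subset⟩
    · intro A hA
      exact (S.card_facet (S.mem_star.1 hA).1).le
  have hτW : τ ⊆ W := by
    obtain ⟨A, hA⟩ := hTne
    exact (S.mem_star.1 hA).2.trans (Finset.subset_biUnion_of_mem S.facet hA)
  -- Count the pairs of a vertex and a facet of the star containing it. Removing the vertices of `τ`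
  -- leaves `2 |T|`.
  have hcount : ∑ u ∈ W, (S.star (insert u τ)).card = (d + 2) * T.card := by
    have := Finset.sum_card_bipartiteAbove_eq_sum_card_bipartiteBelow (s := W) (t := T)
      (fun u A => u ∈ S.facet A)
    unfold Finset.bipartiteAbove Finset.bipartiteBelow at this
    simp only [hfil]
    rw [this, Finset.sum_congr rfl (g := fun _ => d + 2), Finset.sum_const, smul_eq_mul, mul_comm]
    intro A hA
    rw [← S.card_facet (S.mem_star.1 hA).1]
    congr 1
    ext u
    rw [Finset.mem_filter]
    exact ⟨fun h => h.2, fun h => ⟨Finset.mem_biUnion.2 ⟨A, hA, h⟩, h⟩⟩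
  have hcount' : ∑ u ∈ W \ τ, (S.star (insert u τ)).card = 2 * T.card := by
    have h1 := Finset.sum_sdiff (f := fun u => (S.star (insert u τ)).card) hτW
    have h2 : ∑ u ∈ τ, (S.star (insert u τ)).card = d * T.card := by
      rw [Finset.sum_congr rfl (g := fun _ => T.card), Finset.sum_const, hτ, smul_eq_mul]
      intro u hu
      rw [Finset.insert_eq_of_mem hu]
    rw [h2, hcount] at h1
    linarith
  -- Every summand is at most `2`, and three of them are `1`, so `2|T| + 3 ≤ 2 |W \ τ|`; but
  -- connectedness gives `|W \ τ| ≤ |T| + 1`.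
  have hle : ∑ u ∈ W \ τ, ((S.star (insert u τ)).card + if u ∈ ({x, y, z} : Finset _) then 1 else 0)
      ≤ ∑ u ∈ W \ τ, 2 := by
    refine Finset.sum_le_sum fun u hu => ?_
    split_ifs with h
    · simp only [Finset.mem_insert, Finset.mem_singleton] at h
      rcases h with rfl | rfl | rfl <;> omega
    · refine S.card_star_le_two hd ?_
      rw [Finset.card_insert_of_notMem (Finset.mem_sdiff.1 hu).2, hτ]
  have hsub : ({x, y, z} : Finset (Vertex d)) ⊆ W \ τ := by
    intro u hu
    simp only [Finset.mem_insert, Finset.mem_singleton] at hu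
    rw [Finset.mem_sdiff]
    rcases hu with rfl | rfl | rfl
    · exact ⟨(hpos _ hx1).1, hx⟩
    · exact ⟨(hpos _ hy1).1, hy⟩
    · exact ⟨(hpos _ hz1).1, hz⟩
  have h3 : ({x, y, z} : Finset (Vertex d)).card = 3 :=
    Finset.card_eq_three.2 ⟨x, y, z, hxy, hzx.symm, hzy.symm, rfl⟩
  rw [Finset.sum_add_distrib, hcount', Finset.sum_ite_mem, Finset.inter_eq_right.2 hsub,
    Finset.sum_const, Finset.sum_const, h3, Finset.card_sdiff_of_subset hτW, hτ] at hle
  have := Finset.card_le_card hτW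
  simp only [smul_eq_mul] at hle
  omega

/-! ### The boundary chain. -/

/-- The coefficient with which the ordered `d`-simplex `v` occurs in the boundary of the oriented
facet `A`. -/
def coeff (A : ℕ × Vertex d) (v : Fin (d + 1) → Vertex d) : ℤ :=
  -- `π 0` is the omitted position, put in front of the others.
  ∑ π : Perm (Fin (d + 2)), if ∀ q, v q = S.vert A (π q.succ) then
    (((-1) ^ A.1 * Perm.sign π : ℤˣ) : ℤ) else 0

/-- The coefficient of the ordered `d`-simplex `v` in the boundary chain. -/
def bd (v : Fin (d + 1) → Vertex d) : ℤ :=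
  ∑ A ∈ Finset.range (d + 2) ×ˢ (Finset.univ : Finset (Vertex d)), S.coeff A v

/-- This is `∂∂ = 0` for a single facet: interchanging the two omitted vertices is a sign-reversing
involution on the terms. -/
theorem sum_coeff_cons (A : ℕ × Vertex d) (w : Fin d → Vertex d) :
    ∑ y, S.coeff A (Fin.cons y w : Fin (d + 1) → Vertex d) = 0 := by
  unfold coeff
  rw [Finset.sum_comm]
  have h : ∀ π : Perm (Fin (d + 2)), (∑ y, if ∀ q, (Fin.cons y w : Fin (d + 1) → Vertex d) q =
      S.vert A (π q.succ) then (((-1) ^ A.1 * Perm.sign π : ℤˣ) : ℤ) else 0) =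
      if ∀ q : Fin d, w q = S.vert A (π q.succ.succ) then
        (((-1) ^ A.1 * Perm.sign π : ℤˣ) : ℤ) else 0 := by
    intro π
    simp only [Fin.forall_fin_succ (n := d), Fin.cons_zero, Fin.cons_succ, ite_and]
    rw [Finset.sum_ite_eq' Finset.univ]
    simp
  simp only [h]
  have hs := Equiv.sum_comp (Equiv.mulRight (swap (0 : Fin (d + 2)) 1))
    (fun π : Perm (Fin (d + 2)) => if ∀ q : Fin d, w q = S.vert A (π q.succ.succ) then
        (((-1) ^ A.1 * Perm.sign π : ℤˣ) : ℤ) else 0)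
  have hneg : ∀ π : Perm (Fin (d + 2)),
      (if ∀ q : Fin d, w q = S.vert A ((Equiv.mulRight (swap (0 : Fin (d + 2)) 1) π) q.succ.succ)
        then (((-1) ^ A.1 *
          Perm.sign (Equiv.mulRight (swap (0 : Fin (d + 2)) 1) π) : ℤˣ) : ℤ) else 0) =
      -(if ∀ q : Fin d, w q = S.vert A (π q.succ.succ) then
        (((-1) ^ A.1 * Perm.sign π : ℤˣ) : ℤ) else 0) := by
    intro π
    have hsw : ∀ q : Fin d, swap (0 : Fin (d + 2)) 1 q.succ.succ = q.succ.succ := by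
      intro q
      apply swap_apply_of_ne_of_ne
      · exact Fin.succ_ne_zero _
      · rw [← Fin.succ_zero_eq_one]
        exact fun h => Fin.succ_ne_zero _ (Fin.succ_injective _ h)
    simp only [Equiv.coe_mulRight, Perm.mul_apply, hsw, Perm.sign_mul,
      Perm.sign_swap (show (0 : Fin (d + 2)) ≠ 1 from Fin.zero_ne_one)]
    split_ifs <;> simp
  simp only [hneg] at hs
  rw [Finset.sum_neg_distrib] at hs
  linarith

theorem sum_bd_cons (w : Fin d → Vertex d) :
    ∑ y, S.bd (Fin.cons y w : Fin (d + 1) → Vertex d) = 0 := by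
  unfold bd
  rw [Finset.sum_comm]
  exact Finset.sum_eq_zero fun A _ => S.sum_coeff_cons A w

theorem coeff_comp (A : ℕ × Vertex d) (v : Fin (d + 1) → Vertex d) (σ : Perm (Fin (d + 1))) :
    S.coeff A (v ∘ σ) = Perm.sign σ * S.coeff A v := by
  unfold coeff
  -- Reindex by `σ` extended to `Fin (d + 2)` so as to fix `0`, which keeps its sign.
  rw [← Equiv.sum_comp (Equiv.mulRight (Perm.decomposeFin.symm (0, σ))), Finset.mul_sum]
  refine Finset.sum_congr rfl fun π _ => ?_
  have h : ∀ q : Fin (d + 1), Perm.decomposeFin.symm (0, σ) q.succ = (σ q).succ := by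
    intro q
    simp
  have h2 : (∀ q, (v ∘ σ) q = S.vert A (π (σ q).succ)) ↔ ∀ q, v q = S.vert A (π q.succ) :=
    ⟨fun h q => by simpa using h (σ.symm q), fun h q => h (σ q)⟩
  simp only [Equiv.coe_mulRight, Perm.mul_apply, h, h2, Perm.sign_mul,
    Perm.decomposeFin.symm_sign, if_true]
  split_ifs
  · push_cast
    ring
  · simp

theorem bd_comp (v : Fin (d + 1) → Vertex d) (σ : Perm (Fin (d + 1))) :
    S.bd (v ∘ σ) = Perm.sign σ * S.bd v := by
  unfold bd
  rw [Finset.mul_sum]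
  exact Finset.sum_congr rfl fun A _ => S.coeff_comp A v σ

theorem coeff_eq {A : ℕ × Vertex d} (hA : A.1 ≤ d + 1) {v : Fin (d + 1) → Vertex d}
    {π : Perm (Fin (d + 2))} (h : ∀ q, v q = S.vert A (π q.succ)) :
    S.coeff A v = (((-1) ^ A.1 * Perm.sign π : ℤˣ) : ℤ) := by
  unfold coeff
  rw [Finset.sum_eq_single π, if_pos h]
  · intro π' _ hne
    rw [if_neg]
    intro h'
    apply hne
    have hs : ∀ q : Fin (d + 1), π' q.succ = π q.succ := fun q =>
      S.vert_injective A hA ((h' q).symm.trans (h q))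
    ext1 q
    induction q using Fin.cases with
    | succ q => exact hs q
    | zero =>
      obtain ⟨r, hr⟩ := π.surjective (π' 0)
      induction r using Fin.cases with
      | zero => exact hr.symm
      | succ r =>
        rw [← hs r] at hr
        exact (Fin.succ_ne_zero _ (π'.injective hr)).elim
  · simp

theorem coeff_eq_zero {A : ℕ × Vertex d} {v : Fin (d + 1) → Vertex d}
    (h : ∀ π : Perm (Fin (d + 2)), ¬ ∀ q, v q = S.vert A (π q.succ)) : S.coeff A v = 0 :=
  Finset.sum_eq_zero fun π _ => if_neg (h π)

theorem bd_eq_zero_of_not_injective {v : Fin (d + 1) → Vertex d}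
    (h : ¬ Function.Injective v) : S.bd v = 0 := by
  refine Finset.sum_eq_zero fun A hA => S.coeff_eq_zero fun π hπ => h ?_
  intro q r hqr
  rw [hπ, hπ] at hqr
  have hA' : A.1 ≤ d + 1 := by
    simp only [Finset.mem_product, Finset.mem_range] at hA
    omega
  exact Fin.succ_injective _ (π.injective (S.vert_injective A hA' hqr))

theorem bd_eq_sum_star (v : Fin (d + 1) → Vertex d) :
    S.bd v = ∑ A ∈ S.star (Finset.univ.image v), S.coeff A v := by
  unfold bd star
  rw [Finset.sum_filter_of_ne]
  intro A _ hne
  by_contra hsub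
  refine hne (S.coeff_eq_zero fun π hπ => hsub fun x hx => ?_)
  obtain ⟨q, -, rfl⟩ := Finset.mem_image.1 hx
  exact S.mem_facet.2 ⟨_, (hπ q).symm⟩

theorem exists_perm {A : ℕ × Vertex d} {v : Fin (d + 1) → Vertex d} (hv : Function.Injective v)
    (h : Finset.univ.image v ⊆ S.facet A) :
    ∃ π : Perm (Fin (d + 2)), ∀ q, v q = S.vert A (π q.succ) := by
  have h' : ∀ q, ∃ r, S.vert A r = v q := fun q =>
    S.mem_facet.1 (h (Finset.mem_image_of_mem v (Finset.mem_univ q)))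
  choose f hf using h'
  have hfi : Function.Injective f := fun q r hqr => hv (by rw [← hf, ← hf, hqr])
  obtain ⟨x, hx⟩ : ∃ x, x ∉ Set.range f := by
    by_contra! hc
    have := Fintype.card_le_of_surjective f hc
    simp at this
  have hinj : Function.Injective (Fin.cons x f : Fin (d + 2) → Fin (d + 2)) :=
    Fin.cons_injective_iff.2 ⟨hx, hfi⟩
  exact ⟨Equiv.ofBijective _ (Finite.injective_iff_bijective.1 hinj), fun q => by simp [hf]⟩

theorem isUnit_bd {v : Fin (d + 1) → Vertex d} (hv : Function.Injective v)
    (h : (S.star (Finset.univ.image v)).card = 1) : S.bd v = 1 ∨ S.bd v = -1 := by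
  obtain ⟨A, hA⟩ := Finset.card_eq_one.1 h
  have hA' : A ∈ S.star (Finset.univ.image v) := hA ▸ Finset.mem_singleton_self A
  rw [mem_star] at hA'
  obtain ⟨π, hπ⟩ := S.exists_perm hv hA'.2
  rw [bd_eq_sum_star, hA, Finset.sum_singleton, S.coeff_eq hA'.1 hπ]
  rcases Int.units_eq_one_or ((-1) ^ A.1 * Perm.sign π) with h | h <;> simp [h]

/-- The face lies in no facet or in two neighbouring ones, whose contributions cancel by `sign_eq`;
evenness of `d` enters here. -/
theorem bd_eq_zero (hd : 2 ≤ d) (he : Even d) {v : Fin (d + 1) → Vertex d}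
    (h : (S.star (Finset.univ.image v)).card ≠ 1) : S.bd v = 0 := by
  by_cases hv : Function.Injective v
  swap
  · exact S.bd_eq_zero_of_not_injective hv
  have hcard : (Finset.univ.image v).card = d + 1 := by
    rw [Finset.card_image_of_injective _ hv]; simp
  rw [bd_eq_sum_star]
  have hle := S.card_star_le_two hd hcard
  obtain h0 | h2 : (S.star (Finset.univ.image v)).card = 0 ∨
    (S.star (Finset.univ.image v)).card = 2 := by omega
  · rw [Finset.card_eq_zero.1 h0, Finset.sum_empty]
  obtain ⟨A, B, hAB, hs⟩ := Finset.card_eq_two.1 h2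
  have hA : A ∈ S.star (Finset.univ.image v) := by rw [hs]; simp
  have hB : B ∈ S.star (Finset.univ.image v) := by rw [hs]; simp
  obtain ⟨p, hp, hadj⟩ := S.exists_adj_of_mem_star hd hcard hA
  have hAdj := hadj B hB hAB.symm
  obtain ⟨θ, hθ⟩ := hAdj.exists_matches
  have hA1 := (S.mem_star.1 hA).1
  obtain ⟨π, hπ⟩ := S.exists_perm hv (S.mem_star.1 hA).2
  have hB' : ∀ q, v q = S.vert B ((θ * π) q.succ) := by
    intro q
    rw [hπ q, Perm.mul_apply]
    apply hθ.vert_eq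
    intro hc
    have : v q ∈ Finset.univ.image v := Finset.mem_image_of_mem v (Finset.mem_univ q)
    rw [hp, hπ q, hc] at this
    exact Finset.notMem_erase _ _ this
  rw [hs, Finset.sum_pair hAB, S.coeff_eq hA1 hπ, S.coeff_eq (S.mem_star.1 hB).1 hB',
    Perm.sign_mul, ← mul_assoc, hθ.sign_eq he]
  simp

/-- Evaluate `∂∂ = 0` at the common face of `v` and `w`: by `card_star_insert` no third boundary
face contains it, so only two terms survive. -/
theorem bd_eq_neg (hd : 2 ≤ d) (he : Even d) {v w : Fin (d + 1) → Vertex d}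
    (hv : Function.Injective v) (hw : Function.Injective w)
    (hv1 : (S.star (Finset.univ.image v)).card = 1)
    (hw1 : (S.star (Finset.univ.image w)).card = 1) (i : Fin (d + 1))
    (hvw : ∀ j, j ≠ i → v j = w j) (hi : v i ≠ w i) : S.bd w = -S.bd v := by
  set σ : Perm (Fin (d + 1)) := swap 0 i with hσ
  set t : Fin d → Vertex d := fun q => v (σ q.succ) with ht
  have hne : ∀ q : Fin d, σ q.succ ≠ i := by
    intro q hq
    have : σ q.succ = σ 0 := by rw [hq, hσ, swap_apply_left]
    exact Fin.succ_ne_zero _ (σ.injective this)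
  have hv' : v ∘ σ = Fin.cons (v i) t := by
    ext1 q
    induction q using Fin.cases with
    | zero => simp [hσ]
    | succ q => simp [ht]
  have hw' : w ∘ σ = Fin.cons (w i) t := by
    ext1 q
    induction q using Fin.cases with
    | zero => simp [hσ]
    | succ q => simp [ht, hvw _ (hne q)]
  have image_comp : ∀ u : Fin (d + 1) → Vertex d,
      Finset.univ.image (u ∘ σ) = Finset.univ.image u := by
    intro u
    ext x
    simp only [Finset.mem_image, Finset.mem_univ, true_and, Function.comp_apply]
    exact ⟨fun ⟨q, hq⟩ => ⟨_, hq⟩, fun ⟨q, hq⟩ => ⟨σ.symm q, by simpa using hq⟩⟩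
  have image_cons : ∀ y, Finset.univ.image (Fin.cons y t : Fin (d + 1) → Vertex d) =
      insert y (Finset.univ.image t) := by
    intro y
    ext x
    simp only [Finset.mem_image, Finset.mem_univ, true_and, Fin.exists_fin_succ, Fin.cons_zero,
      Fin.cons_succ, Finset.mem_insert]
    tauto
  have hti : Function.Injective t := fun q r h =>
    Fin.succ_injective _ (σ.injective (hv h))
  have hcard : (Finset.univ.image t).card = d := by
    rw [Finset.card_image_of_injective _ hti]; simp
  have hvt : v i ∉ Finset.univ.image t := by
    intro h
    obtain ⟨q, -, hq⟩ := Finset.mem_image.1 h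
    exact hne q (hv hq)
  have hwt : w i ∉ Finset.univ.image t := by
    intro h
    obtain ⟨q, -, hq⟩ := Finset.mem_image.1 h
    rw [ht] at hq
    dsimp only at hq
    rw [hvw _ (hne q)] at hq
    exact hne q (hw hq)
  rw [← image_comp v, hv', image_cons] at hv1
  rw [← image_comp w, hw', image_cons] at hw1
  have hsum := S.sum_bd_cons t
  rw [Fintype.sum_eq_add (v i) (w i) hi, ← hv', ← hw', bd_comp, bd_comp, ← mul_add] at hsum
  · have := (mul_eq_zero.1 hsum).resolve_left (Units.ne_zero _)
    linarith
  · rintro y ⟨hy1, hy2⟩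
    by_cases hyt : y ∈ Finset.univ.image t
    · refine S.bd_eq_zero_of_not_injective fun hinj => ?_
      rw [Fin.cons_injective_iff] at hinj
      obtain ⟨q, -, hq⟩ := Finset.mem_image.1 hyt
      exact hinj.1 ⟨q, hq⟩
    · refine S.bd_eq_zero hd he ?_
      rw [image_cons]
      exact S.card_star_insert hd hcard hi hy1 hy2 hvt hwt hyt hv1 hw1

/-! ### The boundary complex and its orientability for even `d`. -/

/-- The complex generated by all the facets. -/
def solid : PreAbstractSimplicialComplex (Vertex d) :=
  generate {ρ | ∃ A : ℕ × Vertex d, A.1 ≤ d + 1 ∧ ρ = S.facet A}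

theorem mem_solid {ρ : Finset (Vertex d)} :
    ρ ∈ S.solid ↔ ρ.Nonempty ∧ ∃ A : ℕ × Vertex d, A.1 ≤ d + 1 ∧ ρ ⊆ S.facet A := by
  change (ρ.Nonempty ∧ ∃ σ, (∃ A : ℕ × Vertex d, A.1 ≤ d + 1 ∧ σ = S.facet A) ∧ ρ ⊆ σ) ↔ _
  refine and_congr_right fun _ => ⟨?_, ?_⟩
  · rintro ⟨_, ⟨A, hA, rfl⟩, h⟩
    exact ⟨A, hA, h⟩
  · rintro ⟨A, hA, h⟩
    exact ⟨_, ⟨A, hA, rfl⟩, h⟩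

theorem isFacet_solid_iff {σ : Finset (Vertex d)} :
    IsFacet S.solid σ ↔ ∃ A : ℕ × Vertex d, A.1 ≤ d + 1 ∧ σ = S.facet A := by
  constructor
  · rintro ⟨hσ, hmax⟩
    obtain ⟨hne, A, hA, hsub⟩ := S.mem_solid.1 hσ
    exact ⟨A, hA, hsub.antisymm (hmax (S.mem_solid.2 ⟨hne.mono hsub, A, hA, subset_rfl⟩) hsub)⟩
  · rintro ⟨A, hA, rfl⟩
    have hc := S.card_facet hA
    refine ⟨S.mem_solid.2 ⟨Finset.card_pos.1 (by omega), A, hA, subset_rfl⟩, fun τ hτ hsub => ?_⟩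
    obtain ⟨-, B, hB, hτB⟩ := S.mem_solid.1 hτ
    have hc' := S.card_facet hB
    rw [Finset.eq_of_subset_of_card_le (hsub.trans hτB) (by omega)]
    exact hτB

theorem isOrderedFace_boundary_iff (hd : 2 ≤ d) (v : Fin (d + 1) ↪ Vertex d) :
    IsOrderedFace d (boundary (d + 1) S.solid) v ↔
      (S.star (Finset.univ.image v)).card = 1 := by
  unfold IsOrderedFace
  rw [Finset.map_eq_image]
  set ρ := Finset.univ.image v with hρ
  have hcard : ρ.card = d + 1 := by
    rw [hρ, Finset.card_image_of_injective _ v.injective]; simp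
  have hne : ρ.Nonempty := Finset.card_pos.1 (by omega)
  have huniq : (∃! σ, IsFacet S.solid σ ∧ ρ ⊆ σ) ↔ (S.star ρ).card = 1 := by
    rw [Finset.card_eq_one]
    constructor
    · rintro ⟨σ, ⟨h1, h2⟩, h3⟩
      obtain ⟨A, hA, rfl⟩ := S.isFacet_solid_iff.1 h1
      refine ⟨A, Finset.eq_singleton_iff_unique_mem.2 ⟨S.mem_star.2 ⟨hA, h2⟩, fun B hB => ?_⟩⟩
      obtain ⟨hB1, hB2⟩ := S.mem_star.1 hB
      exact S.facet_injective hd hB1 hA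
        (h3 _ ⟨S.isFacet_solid_iff.2 ⟨B, hB1, rfl⟩, hB2⟩)
    · rintro ⟨A, hA⟩
      obtain ⟨h1, h2⟩ := Finset.eq_singleton_iff_unique_mem.1 hA
      rw [mem_star] at h1
      refine ⟨S.facet A, ⟨S.isFacet_solid_iff.2 ⟨A, h1.1, rfl⟩, h1.2⟩, ?_⟩
      rintro σ ⟨h3, h4⟩
      obtain ⟨B, hB, rfl⟩ := S.isFacet_solid_iff.1 h3
      rw [h2 B (S.mem_star.2 ⟨hB, h4⟩)]
  rw [← huniq]
  change (ρ.Nonempty ∧ ∃ σ, (σ ∈ S.solid ∧ σ.card = d + 1 ∧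
    ∃! σ', IsFacet S.solid σ' ∧ σ ⊆ σ') ∧ ρ ⊆ σ) ↔ _
  constructor
  · rintro ⟨-, σ, ⟨-, h1, h2⟩, h3⟩
    rwa [Finset.eq_of_subset_of_card_le h3 (by omega)]
  · intro h
    refine ⟨hne, ρ, ⟨?_, hcard, h⟩, subset_rfl⟩
    obtain ⟨σ, ⟨h1, h2⟩, -⟩ := h
    obtain ⟨A, hA, rfl⟩ := S.isFacet_solid_iff.1 h1
    exact S.mem_solid.2 ⟨hne, A, hA, h2⟩

theorem orientable_boundary (hd : 2 ≤ d) (he : Even d) :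
    Orientable d (boundary (d + 1) S.solid) := by
  classical
  have key : ∀ v : Fin (d + 1) ↪ Vertex d, IsOrderedFace d (boundary (d + 1) S.solid) v →
      (((if S.bd v = 1 then 1 else -1 : ℤˣ)) : ℤ) = S.bd v := by
    intro v hv
    rw [S.isOrderedFace_boundary_iff hd] at hv
    rcases S.isUnit_bd v.injective hv with h | h <;> simp [h]
  refine ⟨fun v => if S.bd v = 1 then 1 else -1, fun v hv π => ?_, fun v w hv hw i hvw hi => ?_⟩
  · have hv' : IsOrderedFace d (boundary (d + 1) S.solid) (π.toEmbedding.trans v) := by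
      unfold IsOrderedFace at hv ⊢
      rwa [← Finset.map_map, Finset.map_univ_equiv]
    rw [Units.ext_iff, Units.val_mul, key _ hv', key _ hv]
    exact S.bd_comp v π
  · rw [Units.ext_iff, Units.val_neg, key _ hv, key _ hw]
    rw [S.isOrderedFace_boundary_iff hd] at hv hw
    exact S.bd_eq_neg hd he v.injective w.injective hv hw i hvw hi

/-! ### Non-orientability for odd `d`. -/

/-- The vertices of `σ_i` without the one in position `r`. -/
def sigmaFace (r : Fin (d + 2)) (i : Vertex d) : Fin (d + 1) ↪ Vertex d :=
  ⟨fun q => S.vert (0, i) (r.succAbove q),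
    (S.vert_injective (0, i) (Nat.zero_le _)).comp Fin.succAbove_right_injective⟩

theorem sigmaFace_apply (r : Fin (d + 2)) (i : Vertex d) (q : Fin (d + 1)) :
    S.sigmaFace r i q = i - ((if q.1 < r.1 then q.1 else q.1 + 1 : ℕ) : Vertex d) := by
  change S.vert (0, i) (r.succAbove q) = _
  rw [vert_zero]
  congr 2
  simp only [Fin.succAbove, Fin.lt_def, Fin.val_castSucc]
  split_ifs <;> rfl

/-- `σ_i` has neighbours only through the positions `0`, `1` and `d + 1`. -/
theorem isOrderedFace_sigmaFace (hd : 2 ≤ d) (r : Fin (d + 2)) (hr : 2 ≤ r.1) (hr' : r.1 ≤ d)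
    (i : Vertex d) : IsOrderedFace d (boundary (d + 1) S.solid) (S.sigmaFace r i) := by
  rw [S.isOrderedFace_boundary_iff hd, Finset.card_eq_one]
  refine ⟨(0, i), Finset.eq_singleton_iff_unique_mem.2 ⟨S.mem_star.2 ⟨Nat.zero_le _, ?_⟩, ?_⟩⟩
  · intro x hx
    obtain ⟨q, -, rfl⟩ := Finset.mem_image.1 hx
    exact S.mem_facet.2 ⟨_, rfl⟩
  · intro B hB
    obtain ⟨hB1, hB2⟩ := S.mem_star.1 hB
    by_contra hne
    have h := S.adj_of_forall_mem hd (p := r) (Nat.zero_le _) hB1 hne (fun q hq => by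
      obtain ⟨q', rfl⟩ := Fin.exists_succAbove_eq hq
      exact hB2 (Finset.mem_image_of_mem _ (Finset.mem_univ q')))
    have := timeOf_cases r
    unfold Adj at h
    dsimp only at h
    omega

/-- Omitting position `2` or `3` from each `σ_i` gives a closed strip of boundary faces. Passing
from `i` to `i + 1` flips the sign once, and the number of vertices is odd. -/
theorem not_orientable_boundary (hd : 2 ≤ d) (ho : Odd d) :
    ¬ Orientable d (boundary (d + 1) S.solid) := by
  rintro ⟨o, hor, hco⟩
  have hd3 : 3 ≤ d := by
    obtain ⟨m, rfl⟩ := ho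
    omega
  set r2 : Fin (d + 2) := ⟨2, by omega⟩ with hr2
  set r3 : Fin (d + 2) := ⟨3, by omega⟩ with hr3
  have f2 := S.isOrderedFace_sigmaFace hd r2 le_rfl hd
  have f3 := S.isOrderedFace_sigmaFace hd r3 (by simp [hr3]) hd3
  have h1 : ∀ i, o (S.sigmaFace r3 i) = -o (S.sigmaFace r2 i) := by
    intro i
    refine hco _ _ (f2 i) (f3 i) ⟨2, by omega⟩ (fun j hj => ?_) (fun h => ?_)
    · have hj' : j.1 ≠ 2 := fun h => hj (Fin.ext h)
      rw [sigmaFace_apply, sigmaFace_apply]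
      congr 2
      simp only [hr2, hr3]
      split_ifs <;> omega
    · rw [sigmaFace_apply, sigmaFace_apply] at h
      simp only [hr2, hr3, lt_irrefl, if_false, Nat.lt_succ_self, if_true] at h
      obtain ⟨x, y, hx, hy, h3, h4⟩ := exists_of_add_mul_eq_zero (d := d) (a := 1) (b := 0)
        (by push_cast at h ⊢; linear_combination -h) (by omega) (by omega) (by omega) (by omega)
      rcases hx with rfl | rfl | rfl <;> rcases hy with rfl | rfl | rfl <;> omega
  -- Both faces omit the vertex `i - 2` and differ only in `i - (d+1)` against `i + 1`. Aligning
  -- their orderings takes a rotation of `d + 1` letters, odd for odd `d`, which cancels the sign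
  -- from coherence.
  have h2 : ∀ i, o (S.sigmaFace r3 (i + 1)) = o (S.sigmaFace r2 i) := by
    intro i
    have hrot : ∀ q : Fin (d + 1), (q.1 = d ∧ (finRotate (d + 1) q).1 = 0) ∨
        (q.1 < d ∧ (finRotate (d + 1) q).1 = q.1 + 1) := by
      obtain ⟨m, rfl⟩ : ∃ m, d = m + 1 := ⟨d - 1, by omega⟩
      exact finRotate_val
    have h := hor _ (f3 (i + 1)) (finRotate (d + 1))
    rw [sign_finRotate, Nat.add_sub_cancel, ho.neg_one_pow, neg_one_mul] at h
    rw [← neg_inj, ← h]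
    refine hco _ _ (f2 i) ?_ (Fin.last d) (fun j hj => ?_) (fun h => ?_)
    · have := f3 (i + 1)
      unfold IsOrderedFace at this ⊢
      rwa [← Finset.map_map, Finset.map_univ_equiv]
    · have hj' : j.1 ≠ d := fun h => hj (Fin.ext h)
      have hj2 : (finRotate (d + 1) j).1 = j.1 + 1 := by have := hrot j; omega
      change _ = S.sigmaFace r3 (i + 1) (finRotate (d + 1) j)
      rw [sigmaFace_apply, sigmaFace_apply, hj2]
      simp only [hr2, hr3]
      split_ifs
      · push_cast; ring
      · omega
      · omega
      · push_cast; ring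
    · have hj2 : (finRotate (d + 1) (Fin.last d)).1 = 0 := by rw [finRotate_last]; rfl
      change _ = S.sigmaFace r3 (i + 1) (finRotate (d + 1) (Fin.last d)) at h
      rw [sigmaFace_apply, sigmaFace_apply, hj2] at h
      rw [if_neg (by simp only [hr2, Fin.val_last]; omega), if_pos (by simp [hr3])] at h
      obtain ⟨x, y, hx, hy, h3, h4⟩ := exists_of_add_mul_eq_zero (d := d) (a := d + 2) (b := 0)
        (by rw [Fin.val_last] at h; push_cast at h ⊢; linear_combination -h) (by omega) (by omega)
        (by omega) (by omega)
      rcases hx with rfl | rfl | rfl <;> rcases hy with rfl | rfl | rfl <;> omega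
  have h3 : ∀ m : ℕ, o (S.sigmaFace r2 (m : Vertex d)) = (-1) ^ m * o (S.sigmaFace r2 0) := by
    intro m
    induction m with
    | zero => simp
    | succ m ih =>
      rw [Nat.cast_succ, ← neg_eq_iff_eq_neg.2 (h1 _), h2, ih, pow_succ]
      simp
  have h4 := h3 (numVertices d)
  have hn : Odd (numVertices d) := by
    obtain ⟨m, rfl⟩ := ho
    exact ⟨2 * m ^ 2 + 7 * m + 5, by simp only [numVertices]; ring⟩
  rw [ZMod.natCast_self, hn.neg_one_pow, neg_one_mul] at h4
  exact units_ne_neg_self _ h4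

/-! ### Identification of the two given families. -/

/-- The schedule of `𝓜`. -/
def ofM (hd : 2 ≤ d) : Schedule d where
  col :=
    { toFun := fun p => ⟨if p.1 = 0 then 0 else if p.1 = 1 then d + 1 else p.1 - 1, by
        split_ifs <;> omega⟩
      invFun := fun m => ⟨if m.1 = 0 then 0 else if m.1 = d + 1 then 1 else m.1 + 1, by
        split_ifs <;> omega⟩
      left_inv := fun p => by
        ext; grind
      right_inv := fun p => by
        ext; grind }
  col_zero p hp := if_pos hp
  col_two p hp := by
    simp only [coe_fn_mk]
    split_ifs <;> omega
  le_timeOf_add p q h := by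
    have h1 := timeOf_cases p
    have h2 := timeOf_cases q
    simp only [coe_fn_mk] at h
    split_ifs at h <;> omega

/-- The schedule of `𝓝`. -/
def ofN (hd : 2 ≤ d) : Schedule d where
  col :=
    { toFun := fun p => ⟨if p.1 = 0 then 0 else if p.1 = 1 then 2 else if p.1 = 2 then 1 else
        d + 4 - p.1, by split_ifs <;> omega⟩
      invFun := fun p => ⟨if p.1 = 0 then 0 else if p.1 = 1 then 2 else if p.1 = 2 then 1 else
        d + 4 - p.1, by split_ifs <;> omega⟩
      left_inv := fun p => by
        ext; grind
      right_inv := fun p => by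
        ext; grind }
  col_zero p hp := if_pos hp
  col_two p hp := by
    simp only [coe_fn_mk]
    split_ifs <;> omega
  le_timeOf_add p q h := by
    have h1 := timeOf_cases p
    have h2 := timeOf_cases q
    simp only [coe_fn_mk] at h
    split_ifs at h <;> omega

/-- As `(d+2)(d+3) = 1`, the multiple `d + 2 - t` yields the vertex `i + t(d+3) - 1`. -/
theorem col_ofM (hd : 2 ≤ d) (p : Fin (d + 2)) :
    ((ofM hd).col p).1 + timeOf p = d + 2 := by
  have h1 := timeOf_cases p
  simp only [ofM, coe_fn_mk]
  split_ifs <;> omega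

/-- The bound excludes position `2`, which is exchanged at time `d + 1` for the multiple `1`, and
position `0`. -/
theorem col_ofN (hd : 2 ≤ d) (p : Fin (d + 2)) (hp : timeOf p ≤ d) :
    ((ofN hd).col p).1 = timeOf p + 1 := by
  have h1 := timeOf_cases p
  simp only [ofN, coe_fn_mk]
  split_ifs <;> omega

theorem facet_zero (i : Vertex d) : S.facet (0, i) = sigmaFacet d i := by
  ext x
  simp only [mem_facet, sigmaFacet, Finset.mem_image, Finset.mem_Icc, vert_zero]
  constructor
  · rintro ⟨p, rfl⟩
    exact ⟨p.1, by omega, rfl⟩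
  · rintro ⟨j, hj, rfl⟩
    exact ⟨⟨j, by omega⟩, rfl⟩

/-- The vertices of the facets after the first step. -/
theorem mem_facet_iff {k : ℕ} (hk : 1 ≤ k) (i x : Vertex d) :
    x ∈ S.facet (k, i) ↔ x = i ∨ (∃ j : ℕ, (2 ≤ j ∧ j ≤ d + 2 - k) ∧ i - (j : Vertex d) = x) ∨
      ∃ p, timeOf p ≤ k ∧ x = i - ((S.col p).1 : Vertex d) * (d + 3) := by
  rw [mem_facet]
  constructor
  · rintro ⟨p, rfl⟩
    have h := timeOf_cases p
    by_cases hp : timeOf p ≤ k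
    · exact Or.inr (Or.inr ⟨p, hp, S.vert_of_le hp⟩)
    · rw [S.vert_of_lt (not_le.1 hp)]
      by_cases h0 : p.1 = 0
      · left; simp [h0]
      · exact Or.inr (Or.inl ⟨p.1, by omega, rfl⟩)
  · rintro (rfl | ⟨j, hj, rfl⟩ | ⟨p, hp, rfl⟩)
    · by_cases hk' : d + 2 ≤ k
      · refine ⟨⟨0, by omega⟩, ?_⟩
        rw [vert_of_le _ (by simpa [timeOf] using hk'), S.col_zero _ rfl]
        simp
      · refine ⟨⟨0, by omega⟩, ?_⟩
        rw [vert_of_lt _ (by simpa [timeOf] using hk')]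
        simp
    · refine ⟨⟨j, by omega⟩, ?_⟩
      have h := timeOf_cases (⟨j, by omega⟩ : Fin (d + 2))
      dsimp only at h
      rw [vert_of_lt _ (by dsimp only; omega)]
    · exact ⟨p, S.vert_of_le hp⟩

theorem exists_ofM_iff (hd : 2 ≤ d) {k : ℕ} (hk : k ≤ d + 1) (i x : Vertex d) :
    (∃ p, timeOf p ≤ k ∧ x = i - (((ofM hd).col p).1 : Vertex d) * (d + 3)) ↔
      ∃ j : ℕ, (1 ≤ j ∧ j ≤ k) ∧ i + ((j * (d + 3) : ℕ) : Vertex d) - 1 = x := by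
  have hs := mul_step_eq_one d
  have key : ∀ p : Fin (d + 2), i + ((timeOf p * (d + 3) : ℕ) : Vertex d) - 1 =
      i - (((ofM hd).col p).1 : Vertex d) * (d + 3) := by
    intro p
    have h := congrArg (Nat.cast : ℕ → Vertex d) (col_ofM hd p)
    push_cast at h ⊢
    linear_combination (d + 3) * h + hs
  constructor
  · rintro ⟨p, hp, rfl⟩
    have := timeOf_cases p
    exact ⟨timeOf p, by omega, key p⟩
  · rintro ⟨j, hj, rfl⟩
    obtain ⟨p, rfl⟩ := exists_timeOf_eq hj.1 (hj.2.trans hk)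
    exact ⟨p, hj.2, key p⟩

theorem facet_ofM_last (hd : 2 ≤ d) (i : Vertex d) :
    (ofM hd).facet (d + 1, i) = muFacetM d i := by
  ext x
  rw [mem_facet_iff _ (by omega), exists_ofM_iff hd le_rfl]
  simp only [muFacetM, Finset.mem_union, Finset.mem_singleton, Finset.mem_image, Finset.mem_Icc]
  refine or_congr_right ⟨?_, Or.inr⟩
  rintro (⟨j, hj, -⟩ | h)
  -- For `k = d + 1` the range `2 ≤ j ≤ d + 2 - k` is empty.
  · omega
  · exact h

theorem facet_ofM (hd : 2 ≤ d) {k : ℕ} (hk : 1 ≤ k) (hk' : k ≤ d) (i : Vertex d) :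
    (ofM hd).facet (k, i) = alphaFacetM d k i := by
  ext x
  rw [mem_facet_iff _ hk, exists_ofM_iff hd (by omega)]
  simp only [alphaFacetM, Finset.mem_union, Finset.mem_singleton, Finset.mem_image,
    Finset.mem_Icc, or_assoc]

theorem facet_ofN_last (hd : 2 ≤ d) (i : Vertex d) :
    (ofN hd).facet (d + 1, i) = muFacetN d i := by
  ext x
  simp only [mem_facet, muFacetN, Finset.mem_image, Finset.mem_Icc, vert_last]
  constructor
  · rintro ⟨p, rfl⟩
    exact ⟨_, ⟨Nat.zero_le _, Nat.lt_succ_iff.1 ((ofN hd).col p).2⟩, by push_cast; rfl⟩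
  · rintro ⟨j, hj, rfl⟩
    obtain ⟨p, hp⟩ := (ofN hd).col.surjective ⟨j, by omega⟩
    exact ⟨p, by rw [hp]; push_cast; rfl⟩

theorem facet_ofN (hd : 2 ≤ d) {k : ℕ} (hk : 1 ≤ k) (hk' : k ≤ d) (i : Vertex d) :
    (ofN hd).facet (k, i) = alphaFacetN d k i := by
  ext x
  rw [mem_facet_iff _ hk]
  simp only [alphaFacetN, Finset.mem_union, Finset.mem_singleton, Finset.mem_image,
    Finset.mem_Icc, or_assoc]
  refine or_congr_right (or_congr_right ⟨?_, ?_⟩)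
  · rintro ⟨p, hp, rfl⟩
    have := timeOf_cases p
    exact ⟨timeOf p + 1, by omega, by rw [col_ofN hd p (by omega)]; push_cast; rfl⟩
  · rintro ⟨j, hj, rfl⟩
    obtain ⟨p, hp⟩ := exists_timeOf_eq (d := d) (k := j - 1) (by omega) (by omega)
    refine ⟨p, by omega, ?_⟩
    rw [col_ofN hd p (by omega), hp, Nat.sub_add_cancel (by omega)]
    push_cast
    rfl

theorem solid_eq_generate (mu : Vertex d → Finset (Vertex d))
    (alpha : ℕ → Vertex d → Finset (Vertex d)) (hmu : ∀ i, S.facet (d + 1, i) = mu i)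
    (halpha : ∀ k i, 1 ≤ k → k ≤ d → S.facet (k, i) = alpha k i) :
    S.solid = generate {ρ | ∃ i, ρ = sigmaFacet d i ∨ ρ = mu i ∨
      ∃ k, 1 ≤ k ∧ k ≤ d ∧ ρ = alpha k i} := by
  unfold solid
  congr 1
  ext ρ
  constructor
  · rintro ⟨⟨k, i⟩, hk, rfl⟩
    refine ⟨i, ?_⟩
    dsimp only at hk
    by_cases h0 : k = 0
    · subst h0
      exact Or.inl (S.facet_zero i)
    by_cases h1 : k = d + 1
    · subst h1
      exact Or.inr (Or.inl (hmu i))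
    exact Or.inr (Or.inr ⟨k, by omega, by omega, halpha k i (by omega) (by omega)⟩)
  · rintro ⟨i, rfl | rfl | ⟨k, hk, hk', rfl⟩⟩
    · exact ⟨(0, i), Nat.zero_le _, (S.facet_zero i).symm⟩
    · exact ⟨(d + 1, i), le_rfl, (hmu i).symm⟩
    · exact ⟨(k, i), by dsimp only; omega, (halpha k i hk hk').symm⟩

theorem boundary_ofM (hd : 2 ≤ d) : manifoldM d = boundary (d + 1) (ofM hd).solid := by
  rw [(ofM hd).solid_eq_generate (muFacetM d) (alphaFacetM d) (facet_ofM_last hd)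
    fun k i hk hk' => facet_ofM hd hk hk' i]
  rfl

theorem boundary_ofN (hd : 2 ≤ d) : manifoldN d = boundary (d + 1) (ofN hd).solid := by
  rw [(ofN hd).solid_eq_generate (muFacetN d) (alphaFacetN d) (facet_ofN_last hd)
    fun k i hk hk' => facet_ofN hd hk hk' i]
  rfl

end Schedule

end SimplicialManifold

theorem mainTheorem6 (d : ℕ) (hd : 2 ≤ d) :
    (Even d → SimplicialManifold.Orientable d (SimplicialManifold.manifoldM d) ∧
      SimplicialManifold.Orientable d (SimplicialManifold.manifoldN d)) ∧
    (Odd d → ¬ SimplicialManifold.Orientable d (SimplicialManifold.manifoldM d) ∧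
      ¬ SimplicialManifold.Orientable d (SimplicialManifold.manifoldN d)) := by
  rw [SimplicialManifold.Schedule.boundary_ofM hd, SimplicialManifold.Schedule.boundary_ofN hd]
  exact ⟨fun h => ⟨SimplicialManifold.Schedule.orientable_boundary _ hd h,
    SimplicialManifold.Schedule.orientable_boundary _ hd h⟩,
    fun h => ⟨SimplicialManifold.Schedule.not_orientable_boundary _ hd h,
    SimplicialManifold.Schedule.not_orientable_boundary _ hd h⟩⟩
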